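/- Consider a stochastic bandit problem with $K\ge 2$ arms: arm $a\in\{1,\dots,K\}$ has an unknown reward distribution $\nu_a$ on $[0,1]$ with expectation $\mu_a$; let $\mu^\star=\max_a\mu_a$ and $\Delta_a=\mu^\star-\mu_a$. At each round $t\ge 1$ the player picks an arm $A_t$ on the basis of the past (possibly with auxiliary randomization) and receives a reward $Y_t$ which, given the past and $A_t$, has distribution $\nu_{A_t}$. Let $N_a(t)=\sum_{s=1}^t \mathbf 1\{A_s=a\}$, let $\widehat\mu_a(t)=\frac1{N_a(t)}\sum_{s=1}^t Y_s\mathbf 1\{A_s=a\}$ when $N_a(t)\ge1$, let $f(t)=\log t+3\log\log t$ for $t\ge3$ and $f(1)=f(2)=f(3)$, and let $d(\mu,\mu')=2(\mu-\mu')^2$. The kl-UCB algorithm with the quadratic divergence $d$ pulls each arm once during the first $K$ rounds and then, for every $t\ge K$, picks an arm $A_{t+1}$ maximizing $$U_a(t)=\sup\Bigl\{\mu\in\mathbb R:\ d\bigl(\widehat\mu_a(t),\mu\bigr)\le \frac{f(t)}{N_a(t)}\Bigr\},$$ ties being broken arbitrarily. Then: (i) $U_a(t)=\widehat\mu_a(t)+\sqrt{f(t)/(2N_a(t))}$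 whenever $N_a(t)\ge1$, so this algorithm is the same as the UCB algorithm, which after the same initialization picks an arm maximizing $\widehat\mu_a(t)+\sqrt{f(t)/(2N_a(t))}$. (ii) For this algorithm, every arm $a$ with $\mu_a<\mu^\star$ and every horizon $T\ge3$, $$\mathbb E[N_a(T)]\le \frac{\log T}{2\Delta_a^2}+\frac{2\sqrt\pi}{\Delta_a^2}\sqrt{\log T+3\log\log T}+\Bigl(4e+\frac{3}{2\Delta_a^2}\Bigr)\log\log T+\frac{8}{\Delta_a^2}+6 .$$ (iii) The leading constant $1/2$ cannot be improved: for every $K\ge2$, every $c<1/2$ and every strategy of the player, there are a bandit problem with $K$ arms and rewards in $[0,1]$ and an arm $a$ with $\mu_a<\mu^\star$ such that $\mathbb E[N_a(T)]>c\,\log T/\Delta_a^2$ for infinitely many $T$. -/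

import Mathlib

open MeasureTheory ProbabilityTheory Filter

noncomputable section

namespace Bandit

/-- A stochastic bandit problem with `K` arms: one reward distribution on `ℝ` per arm. -/
structure Model (K : ℕ) where
  arm : Fin K → Measure ℝ
  isProb : ∀ a, IsProbabilityMeasure (arm a)

/-- All rewards lie in `[0, 1]` (almost surely). -/
def Model.RewardsInUnit {K : ℕ} (ν : Model K) : Prop :=
  ∀ a, ∀ᵐ y ∂(ν.arm a), y ∈ Set.Icc (0 : ℝ) 1

/-- The expectation `μ_a` of arm `a`. -/
def Model.mean {K : ℕ} (ν : Model K) (a : Fin K) : ℝ := ∫ y, y ∂(ν.arm a)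

/-- The largest expectation `μ⋆` (a maximum, as there are finitely many arms). -/
def Model.bestMean {K : ℕ} (ν : Model K) : ℝ := ⨆ a, ν.mean a

/-- The gap `Δ_a = μ⋆ - μ_a`. -/
def Model.gap {K : ℕ} (ν : Model K) (a : Fin K) : ℝ := ν.bestMean - ν.mean a

/-- What the player has seen after `t` rounds: the pairs `(A_s, Y_s)` for the rounds
`s = 1, …, t` (round `s` is stored at position `s - 1`). -/
abbrev History (K t : ℕ) : Type := Fin t → Fin K × ℝ

/-- `N_a(t)`, the number of pulls of arm `a` during the first `t` rounds. -/
def numPulls {K t : ℕ} (h : History K t) (a : Fin K) : ℕ :=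
  (Finset.univ.filter fun s => (h s).1 = a).card

/-- The empirical mean of arm `a` after `t` rounds (meaningful if `numPulls h a ≠ 0`). -/
def empMean {K t : ℕ} (h : History K t) (a : Fin K) : ℝ :=
  (∑ s ∈ Finset.univ.filter (fun s => (h s).1 = a), (h s).2) / (numPulls h a : ℝ)

/-- A (possibly randomized) strategy: `choose t h` is the distribution of the arm `A_{t+1}`
given the history `h` of the first `t` rounds. -/
structure Strategy (K : ℕ) where
  choose : (t : ℕ) → Kernel (History K t) (Fin K)
  isMarkov : ∀ t, IsMarkovKernel (choose t)

/-- The reward received in a round, given the past and the arm just chosen, is distributed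
according to the chosen arm. -/
def Model.rewardKernel {K : ℕ} (ν : Model K) (t : ℕ) : Kernel (History K t × Fin K) ℝ :=
  (Kernel.ofFunOfCountable ν.arm).comap Prod.snd measurable_snd

/-- The joint law of `(A_1, Y_1), …, (A_t, Y_t)` when the strategy `π` plays against `ν`. -/
def historyLaw {K : ℕ} (π : Strategy K) (ν : Model K) : (t : ℕ) → Measure (History K t)
  | 0 => Measure.dirac Fin.elim0
  | t + 1 =>
    (((historyLaw π ν t) ⊗ₘ (π.choose t)) ⊗ₘ (ν.rewardKernel t)).map
      fun p : (History K t × Fin K) × ℝ =>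
        (Fin.snoc (α := fun _ => Fin K × ℝ) p.1.1 (p.1.2, p.2) : History K (t + 1))

/-- `E[N_a(T)]`, the expected number of draws of arm `a` during the rounds `1, …, T`. -/
def expectedPulls {K : ℕ} (π : Strategy K) (ν : Model K) (a : Fin K) (T : ℕ) : ℝ :=
  ∫ h, (numPulls h a : ℝ) ∂(historyLaw π ν T)

/-- The strategies that pull each arm once during the first `K` rounds (in any order) and then,
at every round `t + 1 > K`, pull an arm that maximizes the index `U` computed from the first `t`
rounds (ties are broken arbitrarily, possibly at random). -/
def Strategy.FollowsIndex {K : ℕ} (π : Strategy K)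
    (U : (t : ℕ) → History K t → Fin K → ℝ) : Prop :=
  ∀ (t : ℕ) (h : History K t),
    (t < K → π.choose t h {a | numPulls h a = 0} = 1) ∧
    (K ≤ t → (∀ a, 0 < numPulls h a) → π.choose t h {a | ∀ b, U t h b ≤ U t h a} = 1)

/-- The index of the kl-UCB algorithm with divergence `d` and exploration function `f`,
the supremum being over all real candidate means. -/
def klUCBIndex {K : ℕ} (d : ℝ → ℝ → ℝ) (f : ℕ → ℝ)
    (t : ℕ) (h : History K t) (a : Fin K) : ℝ :=
  sSup {m : ℝ | d (empMean h a) m ≤ f t / (numPulls h a : ℝ)}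

/-- The quadratic divergence: the Kullback-Leibler divergence between normal distributions
of variance `1 / 4` with means `m` and `m'`. -/
def dQua (m m' : ℝ) : ℝ := 2 * (m - m') ^ 2

/-- `f(t) = log t + 3 log log t` for `t ≥ 3`, and `f(1) = f(2) = f(3)`. -/
def explorationRate (t : ℕ) : ℝ :=
  Real.log (max t 3 : ℕ) + 3 * Real.log (Real.log (max t 3 : ℕ))

/-- The upper-confidence bound of the UCB algorithm. -/
def ucbIndex {K : ℕ} (t : ℕ) (h : History K t) (a : Fin K) : ℝ :=
  empMean h a + Real.sqrt (explorationRate t / (2 * (numPulls h a : ℝ)))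

end Bandit

end

namespace Bandit

/-! ### Histories and their laws, one round at a time. -/

variable {K t : ℕ}

/-! (i) A sublevel set of the quadratic divergence is an interval centred at the empirical mean,
whose right end is the UCB index.

(ii) A suboptimal arm `a` is pulled after initialization only if its count is at most `n₀ ≈ f(T) /
(2Δ²)`, or the index of a best arm lies below its mean, or the empirical mean of `a` is too large
(`ae_choose_le`). The first case costs one unit per value of the count. The second has probability
of order `1 / (t log t)` by peeling (`historyLaw_ucb_lt_mean_le`), which sums to `log log T`. The
third is Hoeffding's inequality for each count `n > n₀`, summed by Gaussian and geometric tails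
(`sum_exp_deviation_le`). No i.i.d. sequence of rewards per arm is introduced: both deviation bounds
follow from one exponential supermartingale over the adaptive history (`stopped_supermartingale`).

(iii) If a strategy beat a constant `c < 1/2` on every problem, take Bernoulli arms of mean `1/2`,
one raised by `δ`, and a second problem where another arm is raised by slightly more. The two
history laws have divergence about `2δ² · E[N_a(T)] ≤ θ log T` with `θ < 1`, so Bretagnolle-Huber
(`exp_neg_divergence_le`) bounds the error of any test between them below by a multiple of `T^(-θ)`.
Testing whether `N_a ≤ T/2` has error `O(log T / T)` by Markov, a contradiction. -/

instance (ν : Model K) (a : Fin K) : IsProbabilityMeasure (ν.arm a) := ν.isProb a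

instance (π : Strategy K) (t : ℕ) : IsMarkovKernel (π.choose t) := π.isMarkov t

instance (ν : Model K) (t : ℕ) : IsMarkovKernel (ν.rewardKernel t) := by
  refine ⟨fun p => ?_⟩
  rw [Model.rewardKernel, Kernel.comap_apply]
  exact ν.isProb p.2

/-- The history `h` followed by a round in which arm `b` is pulled and yields `y`. -/
abbrev History.snoc (h : History K t) (b : Fin K) (y : ℝ) : History K (t + 1) :=
  Fin.snoc (α := fun _ => Fin K × ℝ) h (b, y)

lemma measurable_historySnoc :
    Measurable fun p : (History K t × Fin K) × ℝ => p.1.1.snoc p.1.2 p.2 := by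
  refine measurable_pi_lambda _ fun i => ?_
  refine Fin.lastCases ?_ (fun j => ?_) i
  · simp only [History.snoc, Fin.snoc_last]
    fun_prop
  · simp only [History.snoc, Fin.snoc_castSucc]
    fun_prop

instance isProbabilityMeasure_historyLaw (π : Strategy K) (ν : Model K) (t : ℕ) :
    IsProbabilityMeasure (historyLaw π ν t) := by
  induction t with
  | zero => rw [historyLaw]; infer_instance
  | succ t ih =>
    rw [historyLaw]
    exact Measure.isProbabilityMeasure_map measurable_historySnoc.aemeasurable

lemma sum_choose_singleton (π : Strategy K) (h : History K t) :
    ∑ b, π.choose t h {b} = 1 := by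
  simp

/-- The one-step recursion behind every induction over rounds. -/
lemma lintegral_historyLaw_succ (π : Strategy K) (ν : Model K) {F : History K (t + 1) → ENNReal}
    (hF : Measurable F) :
    ∫⁻ h, F h ∂historyLaw π ν (t + 1) =
      ∫⁻ h, ∑ b, π.choose t h {b} * ∫⁻ y, F (h.snoc b y) ∂ν.arm b ∂historyLaw π ν t := by
  have hm := hF.comp (measurable_historySnoc (K := K) (t := t))
  rw [historyLaw, lintegral_map hF measurable_historySnoc]
  have h1 := Measure.lintegral_compProd (μ := historyLaw π ν t ⊗ₘ π.choose t)
    (κ := ν.rewardKernel t) hm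
  refine h1.trans ?_
  rw [Measure.lintegral_compProd hm.lintegral_kernel_prod_right']
  refine lintegral_congr fun h => ?_
  rw [lintegral_fintype]
  refine Finset.sum_congr rfl fun b _ => ?_
  rw [mul_comm]
  rfl

/-! ### Sums over the rewards of one arm: supermartingale and Wald identity. -/

/-- The sum of `g y` over the rewards `y` obtained from arm `a`. -/
def armSum {M : Type*} [AddCommMonoid M] (g : ℝ → M) (h : History K t) (a : Fin K) : M :=
  ∑ s with (h s).1 = a, g (h s).2

lemma armSum_snoc {M : Type*} [AddCommMonoid M] (g : ℝ → M) (h : History K t) (a b : Fin K)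
    (y : ℝ) : armSum g (h.snoc b y) a = armSum g h a + if b = a then g y else 0 := by
  simp only [armSum, Finset.sum_filter, Fin.sum_univ_castSucc, History.snoc, Fin.snoc_castSucc,
    Fin.snoc_last]

lemma armSum_one_eq_numPulls (h : History K t) (a : Fin K) :
    armSum (fun _ => (1 : ℕ)) h a = numPulls h a := by
  simp [armSum, numPulls]

lemma armSum_const (c : ℝ) (h : History K t) (a : Fin K) :
    armSum (fun _ => c) h a = numPulls h a * c := by
  simp [armSum, numPulls]

lemma numPulls_snoc (h : History K t) (a b : Fin K) (y : ℝ) :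
    numPulls (h.snoc b y) a = numPulls h a + if b = a then 1 else 0 := by
  simp only [← armSum_one_eq_numPulls, armSum_snoc]

lemma numPulls_le (h : History K t) (a : Fin K) : numPulls h a ≤ t :=
  (Finset.card_le_univ _).trans_eq (by simp)

lemma sum_numPulls (h : History K t) : ∑ a, numPulls h a = t := by
  simp only [numPulls]
  rw [← Finset.card_eq_sum_card_fiberwise (fun _ _ => by simp)]
  simp

lemma measurable_armSum {M : Type*} [AddCommMonoid M] [MeasurableSpace M] [MeasurableAdd₂ M]
    {g : ℝ → M} (hg : Measurable g) (a : Fin K) :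
    Measurable fun h : History K t => armSum g h a := by
  simp only [armSum, Finset.sum_filter]
  refine Finset.measurable_sum _ fun s _ => ?_
  refine Measurable.ite ?_ (by fun_prop) measurable_const
  exact (measurableSet_singleton a).preimage (by fun_prop : Measurable fun h : History K t => (h s).1)

@[fun_prop]
lemma measurable_numPulls (a : Fin K) : Measurable fun h : History K t => numPulls h a := by
  simp only [← armSum_one_eq_numPulls]
  exact measurable_armSum measurable_const a

lemma measurable_choose (π : Strategy K) (t : ℕ) (a : Fin K) :
    Measurable fun h => π.choose t h {a} :=
  Kernel.measurable_coe _ (measurableSet_singleton a)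

/-- A nonnegative supermartingale built from the rewards of arm `a`, stopped when that arm is
pulled for the `n + 1`-st time. -/
lemma stopped_supermartingale (π : Strategy K) (ν : Model K) (a : Fin K) {g : ℝ → ℝ}
    (hg : Measurable g) (hint : ∫⁻ y, ENNReal.ofReal (Real.exp (g y)) ∂ν.arm a ≤ 1)
    (n T : ℕ) :
    ∫⁻ h, (if numPulls h a ≤ n then ENNReal.ofReal (Real.exp (armSum g h a)) else 0)
        ∂historyLaw π ν T
      + ∑ t ∈ Finset.range T, ∫⁻ h, π.choose t h {a} *
          (if numPulls h a = n then ENNReal.ofReal (Real.exp (armSum g h a)) else 0)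
          ∂historyLaw π ν t ≤ 1 := by
  have hW : ∀ t, Measurable fun h : History K t => ENNReal.ofReal (Real.exp (armSum g h a)) :=
    fun t => ENNReal.measurable_ofReal.comp (Real.measurable_exp.comp (measurable_armSum hg a))
  have hle : ∀ t, Measurable fun h : History K t =>
      if numPulls h a ≤ n then ENNReal.ofReal (Real.exp (armSum g h a)) else 0 := fun t =>
    Measurable.ite (measurableSet_le (measurable_numPulls a) measurable_const) (hW t)
      measurable_const
  have heq : ∀ t, Measurable fun h : History K t =>
      if numPulls h a = n then ENNReal.ofReal (Real.exp (armSum g h a)) else 0 := fun t =>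
    Measurable.ite (measurableSet_eq_fun (measurable_numPulls a) measurable_const) (hW t)
      measurable_const
  induction T with
  | zero =>
    simp only [Finset.range_zero, Finset.sum_empty, add_zero, historyLaw]
    rw [lintegral_dirac' _ (hle 0)]
    simp [armSum, numPulls]
  | succ T ih =>
    refine le_trans ?_ ih
    have hq : Measurable fun h => π.choose T h {a} *
        if numPulls h a = n then ENNReal.ofReal (Real.exp (armSum g h a)) else 0 :=
      (measurable_choose π T a).mul (heq T)
    rw [Finset.sum_range_succ, lintegral_historyLaw_succ π ν (hle (T + 1)), add_comm (Finset.sum _ _),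
      ← add_assoc, ← lintegral_add_right _ hq]
    gcongr with h
    -- Only a pull of `a` matters. Below `n` pulls it multiplies the weight by a factor of mean at
    -- most one; at `n` pulls the weight is killed and moves to the second sum; above `n` there is
    -- no weight left.
    have key : ∀ b, (∫⁻ y, (if numPulls (h.snoc b y) a ≤ n then
        ENNReal.ofReal (Real.exp (armSum g (h.snoc b y) a)) else 0) ∂ν.arm b)
        + (if b = a then (if numPulls h a = n then
          ENNReal.ofReal (Real.exp (armSum g h a)) else 0) else 0)
        ≤ if numPulls h a ≤ n then ENNReal.ofReal (Real.exp (armSum g h a)) else 0 := by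
      intro b
      simp only [numPulls_snoc, armSum_snoc]
      by_cases hb : b = a
      · subst hb
        simp only [if_true]
        rcases lt_trichotomy (numPulls h b) n with hn | hn | hn
        · simp only [Nat.succ_le_of_lt hn, hn.ne, hn.le, if_true, if_false, add_zero, Real.exp_add,
            ENNReal.ofReal_mul (Real.exp_pos _).le]
          rw [lintegral_const_mul _ (by fun_prop)]
          exact mul_le_of_le_one_right' hint
        · simp [hn]
        · simp [hn.ne', hn.not_ge, (hn.trans (Nat.lt_succ_self _)).not_ge]
      · simp [hb]
    calc _ = ∑ b, π.choose T h {b} * ((∫⁻ y, (if numPulls (h.snoc b y) a ≤ n then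
          ENNReal.ofReal (Real.exp (armSum g (h.snoc b y) a)) else 0) ∂ν.arm b)
          + (if b = a then (if numPulls h a = n then
          ENNReal.ofReal (Real.exp (armSum g h a)) else 0) else 0)) := by
          simp only [mul_add, Finset.sum_add_distrib, mul_ite, mul_zero, Finset.sum_ite_eq',
            Finset.mem_univ, if_true]
      _ ≤ ∑ b, π.choose T h {b} *
          if numPulls h a ≤ n then ENNReal.ofReal (Real.exp (armSum g h a)) else 0 := by
          gcongr with b
          exact key b
      _ = _ := by rw [← Finset.sum_mul, sum_choose_singleton, one_mul]

/-- Wald's identity for nonnegative functions of the rewards. -/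
lemma lintegral_armSum (π : Strategy K) (ν : Model K) (a : Fin K) {g : ℝ → ENNReal}
    (hg : Measurable g) (T : ℕ) :
    ∫⁻ h, armSum g h a ∂historyLaw π ν T =
      (∑ t ∈ Finset.range T, ∫⁻ h, π.choose t h {a} ∂historyLaw π ν t) * ∫⁻ y, g y ∂ν.arm a := by
  induction T with
  | zero =>
    rw [historyLaw, lintegral_dirac' _ (measurable_armSum hg a)]
    simp [armSum]
  | succ T ih =>
    rw [lintegral_historyLaw_succ π ν (measurable_armSum hg a), Finset.sum_range_succ, add_mul, ← ih,
      ← lintegral_mul_const _ (measurable_choose π T a),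
      ← lintegral_add_left (measurable_armSum hg a)]
    refine lintegral_congr fun h => ?_
    have : ∀ b, ∫⁻ y, armSum g (h.snoc b y) a ∂ν.arm b
        = armSum g h a + if b = a then ∫⁻ y, g y ∂ν.arm a else 0 := by
      intro b
      simp only [armSum_snoc]
      by_cases hb : b = a
      · subst hb
        simp [lintegral_add_left]
      · simp [hb]
    simp only [this, mul_add, Finset.sum_add_distrib, ← Finset.sum_mul, sum_choose_singleton,
      one_mul, mul_ite, mul_zero, Finset.sum_ite_eq', Finset.mem_univ, if_true]

lemma lintegral_numPulls (π : Strategy K) (ν : Model K) (a : Fin K) (T : ℕ) :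
    ∫⁻ h, (numPulls h a : ENNReal) ∂historyLaw π ν T =
      ∑ t ∈ Finset.range T, ∫⁻ h, π.choose t h {a} ∂historyLaw π ν t := by
  have h := lintegral_armSum π ν a (g := fun _ => 1) measurable_const T
  simpa [armSum, numPulls] using h

lemma integrable_numPulls (π : Strategy K) (ν : Model K) (a : Fin K) (T : ℕ) :
    Integrable (fun h => (numPulls h a : ℝ)) (historyLaw π ν T) := by
  refine Integrable.of_bound (C := T) (by fun_prop) (ae_of_all _ fun h => ?_)
  simpa using numPulls_le h a

lemma ofReal_expectedPulls (π : Strategy K) (ν : Model K) (a : Fin K) (T : ℕ) :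
    ENNReal.ofReal (expectedPulls π ν a T) =
      ∑ t ∈ Finset.range T, ∫⁻ h, π.choose t h {a} ∂historyLaw π ν t := by
  rw [← lintegral_numPulls, expectedPulls,
    ofReal_integral_eq_lintegral_ofReal (integrable_numPulls π ν a T)
      (ae_of_all _ fun h => by positivity)]
  simp

lemma expectedPulls_nonneg (π : Strategy K) (ν : Model K) (a : Fin K) (T : ℕ) :
    0 ≤ expectedPulls π ν a T :=
  integral_nonneg fun _ => by positivity

/-! ### The initialization rounds. -/

lemma mem_of_choose_eq_one {π : Strategy K} {h : History K t} {s : Set (Fin K)}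
    (hs : π.choose t h s = 1) {b : Fin K} (hb : π.choose t h {b} ≠ 0) : b ∈ s := by
  by_contra hbs
  refine hb (measure_mono_null (Set.singleton_subset_iff.2 (Set.mem_compl hbs)) ?_)
  exact (prob_compl_eq_zero_iff s.toFinite.measurableSet).2 hs

/-- Propagates an invariant by one round: only arms chosen with positive probability need checking.
-/
lemma ae_historyLaw_succ {π : Strategy K} {ν : Model K} {p : History K (t + 1) → Prop}
    (hp : MeasurableSet {h | p h})
    (H : ∀ᵐ h ∂historyLaw π ν t, ∀ b, π.choose t h {b} ≠ 0 → ∀ y, p (h.snoc b y)) :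
    ∀ᵐ h ∂historyLaw π ν (t + 1), p h := by
  rw [ae_iff]
  have hp' : MeasurableSet {h | ¬ p h} := hp.compl
  rw [← lintegral_indicator_one hp', lintegral_historyLaw_succ _ _ (measurable_one.indicator hp')]
  refine (lintegral_congr_ae ?_).trans lintegral_zero
  filter_upwards [H] with h hh
  refine Finset.sum_eq_zero fun b _ => ?_
  by_cases hb : π.choose t h {b} = 0
  · simp [hb]
  · simp [hh b hb]

lemma numPulls_eq_one {h : History K K} (hle : ∀ a, numPulls h a ≤ 1) (a : Fin K) :
    numPulls h a = 1 := by
  have h1 : ∑ a, numPulls h a = ∑ _a : Fin K, 1 := by simp [sum_numPulls]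
  exact (Finset.sum_eq_sum_iff_of_le fun a _ => hle a).1 h1 a (Finset.mem_univ a)

/-- Once the first `K` rounds have been used to pull the arms not pulled yet, every arm has been
pulled. -/
lemma ae_numPulls_pos {π : Strategy K} (ν : Model K)
    (hπ : ∀ (t : ℕ) (h : History K t), t < K → π.choose t h {a | numPulls h a = 0} = 1) (t : ℕ) :
    ∀ᵐ h ∂historyLaw π ν t, (t ≤ K → ∀ a, numPulls h a ≤ 1) ∧ (K ≤ t → ∀ a, 0 < numPulls h a) := by
  have hm : ∀ t, MeasurableSet {h : History K t |
      (t ≤ K → ∀ a, numPulls h a ≤ 1) ∧ (K ≤ t → ∀ a, 0 < numPulls h a)} := by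
    intro t
    simp only [Set.ofPred_and, Set.ofPred_forall]
    refine MeasurableSet.inter ?_ ?_
    · exact .iInter fun _ => .iInter fun a => measurableSet_le (measurable_numPulls a) measurable_const
    · exact .iInter fun _ => .iInter fun a => measurableSet_lt measurable_const (measurable_numPulls a)
  induction t with
  | zero =>
    rw [historyLaw, ae_dirac_iff (hm 0)]
    refine ⟨fun _ a => by simp [numPulls], fun h a => ?_⟩
    exact absurd a.2 (by omega)
  | succ t ih =>
    refine ae_historyLaw_succ (hm (t + 1)) ?_
    filter_upwards [ih] with h hh b hb y
    have hle : t + 1 ≤ K → ∀ a, numPulls (h.snoc b y) a ≤ 1 := by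
      intro ht a
      have h0 : numPulls h b = 0 := mem_of_choose_eq_one (hπ t h ht) hb
      rw [numPulls_snoc]
      split_ifs with hba
      · subst hba; simp [h0]
      · simpa using hh.1 (by omega) a
    refine ⟨hle, fun ht a => ?_⟩
    rcases ht.lt_or_eq with ht | ht
    · have := hh.2 (by omega) a
      rw [numPulls_snoc]
      omega
    · subst ht
      rw [numPulls_eq_one (hle le_rfl) a]
      exact one_pos

/-! ### Deviation inequalities. -/

/-- Hoeffding's lemma on an interval of length one: the variance proxy is `1/4`. This provides the
increments for `stopped_supermartingale`. -/
lemma lintegral_exp_centered_le_one {ν : Model K} (hν : ν.RewardsInUnit) (a : Fin K) (l : ℝ) :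
    ∫⁻ y, ENNReal.ofReal (Real.exp (l * (y - ν.mean a) - l ^ 2 / 8)) ∂ν.arm a ≤ 1 := by
  have hs := hasSubgaussianMGF_of_mem_Icc (μ := ν.arm a) aemeasurable_id (hν a)
  have hm := hs.mgf_le l
  have hi := hs.integrable_exp_mul l
  simp only [mgf, id] at hm hi
  rw [← Model.mean] at hm hi
  have he : ∀ y, Real.exp (l * (y - ν.mean a) - l ^ 2 / 8)
      = Real.exp (-(l ^ 2 / 8)) * Real.exp (l * (y - ν.mean a)) := by
    intro y; rw [← Real.exp_add]; ring_nf
  simp only [he]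
  rw [← ofReal_integral_eq_lintegral_ofReal (hi.const_mul _) (ae_of_all _ fun y => by positivity),
    integral_const_mul]
  refine ENNReal.ofReal_le_one.2 ?_
  calc _ ≤ Real.exp (-(l ^ 2 / 8)) *
        Real.exp (((‖(1 : ℝ) - 0‖₊ / 2) ^ 2 : NNReal) * l ^ 2 / 2) := by gcongr
    _ = 1 := by
      rw [← Real.exp_add, Real.exp_eq_one_iff]
      simp; ring

lemma armSum_centered (h : History K t) (a : Fin K) (l m : ℝ) :
    armSum (fun y => l * (y - m) - l ^ 2 / 8) h a =
      l * (armSum id h a - numPulls h a * m) - numPulls h a * (l ^ 2 / 8) := by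
  simp only [armSum, numPulls, id, Finset.sum_sub_distrib, ← Finset.mul_sum, Finset.sum_const,
    nsmul_eq_mul]

lemma empMean_eq (h : History K t) (a : Fin K) : empMean h a = armSum id h a / numPulls h a := rfl

/-- An arm is pulled at most once after exactly `n` pulls. -/
lemma sum_lintegral_choose_le_one (π : Strategy K) (ν : Model K) (a : Fin K) (n T : ℕ) :
    ∑ t ∈ Finset.range T, ∫⁻ h, π.choose t h {a} * (if numPulls h a = n then 1 else 0)
      ∂historyLaw π ν t ≤ 1 := by
  have := stopped_supermartingale π ν a (g := fun _ => 0) measurable_const (by simp) n T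
  refine le_trans ?_ (le_trans le_add_self this)
  simp [armSum]

/-- Hoeffding's inequality for the first `n` rewards of an arm. -/
lemma sum_lintegral_choose_deviation_le (π : Strategy K) {ν : Model K} (hν : ν.RewardsInUnit)
    (a : Fin K) (n T : ℕ) {x : ℝ} (hx : 0 ≤ x) :
    ∑ t ∈ Finset.range T, ∫⁻ h, π.choose t h {a} *
        (if numPulls h a = n ∧ n * (ν.mean a + x) ≤ armSum id h a then 1 else 0)
      ∂historyLaw π ν t ≤ ENNReal.ofReal (Real.exp (-(2 * n * x ^ 2))) := by
  -- `l = 4x` maximizes `l x - l² / 8`, with value `2x²`.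
  have hs := stopped_supermartingale π ν a (by fun_prop)
    (lintegral_exp_centered_le_one hν a (4 * x)) n T
  have hs' := mul_le_mul_right (le_trans le_add_self hs)
    (ENNReal.ofReal (Real.exp (-(2 * n * x ^ 2))))
  rw [mul_one, Finset.mul_sum] at hs'
  refine le_trans (Finset.sum_le_sum fun t _ => ?_) hs'
  rw [← lintegral_const_mul' _ _ ENNReal.ofReal_ne_top]
  refine lintegral_mono fun h => ?_
  rw [mul_left_comm]
  gcongr
  by_cases hn : numPulls h a = n
  · simp only [hn, true_and, if_true]
    split_ifs with hS
    · rw [← ENNReal.ofReal_mul (Real.exp_pos _).le, ← Real.exp_add, ENNReal.one_le_ofReal,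
        Real.one_le_exp_iff, armSum_centered, hn]
      have := mul_le_mul_of_nonneg_left hS hx
      nlinarith
    · exact zero_le
  · simp [hn]

/-- Markov's inequality for the supermartingale; stopping level `n = t` means that it is never
stopped. The number of pulls stays random, which peeling requires. -/
lemma historyLaw_exp_deviation_le (π : Strategy K) {ν : Model K} (hν : ν.RewardsInUnit)
    (a : Fin K) (t : ℕ) (l c : ℝ) :
    historyLaw π ν t {h | c ≤ l * (armSum id h a - numPulls h a * ν.mean a)
        - numPulls h a * (l ^ 2 / 8)} ≤ ENNReal.ofReal (Real.exp (-c)) := by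
  have hg : Measurable fun y : ℝ => l * (y - ν.mean a) - l ^ 2 / 8 := by fun_prop
  have hs := le_trans le_self_add (stopped_supermartingale π ν a hg
    (lintegral_exp_centered_le_one hν a l) t t)
  simp only [numPulls_le, if_true] at hs
  have hM : AEMeasurable (fun h : History K t => ENNReal.ofReal (Real.exp (armSum
      (fun y : ℝ => l * (y - ν.mean a) - l ^ 2 / 8) h a))) (historyLaw π ν t) :=
    (ENNReal.measurable_ofReal.comp (Real.measurable_exp.comp (measurable_armSum hg a))).aemeasurable
  have := (mul_meas_ge_le_lintegral₀ hM (ENNReal.ofReal (Real.exp c))).trans hs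
  simp only [armSum_centered, ENNReal.ofReal_le_ofReal_iff (Real.exp_pos _).le, Real.exp_le_exp]
    at this
  rw [Real.exp_neg, ENNReal.ofReal_inv_of_pos (Real.exp_pos _)]
  rw [mul_comm] at this
  exact ENNReal.le_inv_iff_mul_le.2 this

/-- A geometric grid on `[1, t]`. -/
lemma exists_pow_le_le_pow_succ {r : ℝ} {D : ℕ} (hD : 0 < D) {x : ℝ} (hx : 1 ≤ x)
    (hxD : x ≤ r ^ D) : ∃ k < D, r ^ k ≤ x ∧ x ≤ r ^ (k + 1) := by
  classical
  have hex : ∃ k, x ≤ r ^ (k + 1) := ⟨D - 1, by rwa [Nat.sub_add_cancel hD]⟩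
  refine ⟨Nat.find hex, ?_, ?_, Nat.find_spec hex⟩
  · have : Nat.find hex ≤ D - 1 := Nat.find_min' hex (by rwa [Nat.sub_add_cancel hD])
    omega
  · rcases Nat.eq_zero_or_pos (Nat.find hex) with h0 | h0
    · rw [h0]; simpa using hx
    · have := Nat.find_min hex (Nat.sub_lt h0 one_pos)
      rw [Nat.sub_add_cancel (Nat.one_le_iff_ne_zero.2 h0.ne')] at this
      exact (not_le.1 this).le

/-- The deviation inequality for the upper-confidence bound of an arm, by peeling over the number
of pulls. -/
lemma historyLaw_ucb_lt_mean_le (π : Strategy K) {ν : Model K} (hν : ν.RewardsInUnit)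
    (a : Fin K) {t : ℕ} (ht : 2 ≤ t) {δ : ℝ} (hδ : 1 < δ) :
    historyLaw π ν t {h | 0 < numPulls h a ∧
        empMean h a + Real.sqrt (δ / (2 * (numPulls h a : ℝ))) < ν.mean a}
      ≤ ENNReal.ofReal (⌈δ * Real.log t⌉₊ * Real.exp (1 - δ)) := by
  set D := ⌈δ * Real.log t⌉₊ with hD
  -- This ratio gives `δ / r = δ - 1`, so a slice of the grid loses only a factor `e`, while `log r
  -- ≥ 1 - 1/r = 1/δ` makes `D` slices cover `[1, t]`.
  set r := δ / (δ - 1) with hr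
  have hδ1 : 0 < δ - 1 := by linarith
  have hr1 : 1 ≤ r := by rw [hr, le_div_iff₀ hδ1]; linarith
  have hr0 : 0 < r := by linarith
  have hlogt : 0 < Real.log t := Real.log_pos (by exact_mod_cast ht)
  have hDpos : 0 < D := Nat.ceil_pos.2 (by positivity)
  have htD : (t : ℝ) ≤ r ^ D := by
    have h1 : δ⁻¹ ≤ Real.log r := by
      refine le_trans (le_of_eq ?_) (Real.one_sub_inv_le_log_of_pos hr0)
      rw [hr]; field_simp; ring
    have h2 : Real.log t ≤ D * Real.log r := by
      calc Real.log t = (δ * Real.log t) * δ⁻¹ := by field_simp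
        _ ≤ D * Real.log r := by
          gcongr
          exact Nat.le_ceil _
    rw [← Real.log_pow] at h2
    exact (Real.log_le_log_iff (by positivity) (by positivity)).1 h2
  have hsub : {h : History K t | 0 < numPulls h a ∧
        empMean h a + Real.sqrt (δ / (2 * (numPulls h a : ℝ))) < ν.mean a} ⊆
      ⋃ k ∈ Finset.range D, {h | δ - 1 ≤ (-(4 * Real.sqrt (δ / (2 * r ^ (k + 1))))) *
        (armSum id h a - numPulls h a * ν.mean a)
        - numPulls h a * ((-(4 * Real.sqrt (δ / (2 * r ^ (k + 1))))) ^ 2 / 8)} := by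
    rintro h ⟨hN, hlt⟩
    have hN1 : (1 : ℝ) ≤ numPulls h a := by exact_mod_cast hN
    have hNt : (numPulls h a : ℝ) ≤ t := by exact_mod_cast numPulls_le h a
    obtain ⟨k, hk, hk1, hk2⟩ := exists_pow_le_le_pow_succ hDpos hN1 (hNt.trans htD)
    simp only [Set.mem_iUnion, Finset.mem_range, Set.mem_ofPred_eq]
    refine ⟨k, hk, ?_⟩
    rw [empMean_eq] at hlt
    set N : ℝ := (numPulls h a : ℝ)
    set S := armSum id h a
    set m := ν.mean a
    have hN0 : 0 < N := by linarith
    -- On a slice the radius is replaced by its value `s` at the right end, so that `l = -4s` no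
    -- longer depends on the random count. The exponent is then at least `4Ns² - 2Ns² = 2Ns² ≥ δ -
    -- 1`.
    have hsq : Real.sqrt (δ / (2 * r ^ (k + 1))) ≤ Real.sqrt (δ / (2 * N)) :=
      Real.sqrt_le_sqrt (by gcongr)
    set s := Real.sqrt (δ / (2 * r ^ (k + 1))) with hs
    have hs0 : 0 ≤ s := Real.sqrt_nonneg _
    have hs2 : s ^ 2 = δ / (2 * r ^ (k + 1)) := Real.sq_sqrt (by positivity)
    have hdev : N * s ≤ N * m - S := by
      have : S / N + s < m := by linarith
      have := mul_lt_mul_of_pos_left this hN0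
      rw [mul_add, mul_div_cancel₀ _ hN0.ne'] at this
      linarith
    have hmain : δ - 1 ≤ 2 * N * s ^ 2 := by
      rw [hs2]
      have : δ - 1 = 2 * r ^ k * (δ / (2 * r ^ (k + 1))) := by
        rw [pow_succ]
        have : δ / r = δ - 1 := by rw [hr]; field_simp
        rw [← this]; field_simp
      rw [this]
      gcongr
    nlinarith [mul_le_mul_of_nonneg_left hdev hs0]
  refine (measure_mono hsub).trans ((measure_biUnion_finset_le _ _).trans ?_)
  refine (Finset.sum_le_sum fun k _ => historyLaw_exp_deviation_le π hν a t _ _).trans ?_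
  rw [Finset.sum_const, Finset.card_range, nsmul_eq_mul, ENNReal.ofReal_mul (by positivity),
    ENNReal.ofReal_natCast, neg_sub]

/-! ### The exploration rate and the failures of the upper-confidence bound. -/

lemma one_lt_log_three : 1 < Real.log 3 := by
  rw [Real.lt_log_iff_exp_lt (by norm_num)]
  exact Real.exp_one_lt_d9.trans (by norm_num)

lemma one_lt_log_natCast {t : ℕ} (ht : 3 ≤ t) : 1 < Real.log t :=
  one_lt_log_three.trans_le (Real.log_le_log (by norm_num) (by exact_mod_cast ht))

lemma explorationRate_of_le {t : ℕ} (ht : 3 ≤ t) :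
    explorationRate t = Real.log t + 3 * Real.log (Real.log t) := by
  rw [explorationRate, max_eq_left ht]

lemma explorationRate_mono : Monotone explorationRate := by
  intro s t hst
  have h1 : Real.log (max s 3 : ℕ) ≤ Real.log (max t 3 : ℕ) :=
    Real.log_le_log (by positivity) (by exact_mod_cast max_le_max_right 3 hst)
  have h0 := one_lt_log_natCast (le_max_right s 3)
  have h2 := Real.log_le_log (by linarith) h1
  simp only [explorationRate]
  linarith

lemma one_lt_explorationRate (t : ℕ) : 1 < explorationRate t := by
  have h0 := one_lt_log_natCast (le_max_right t 3)
  have := Real.log_pos h0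
  simp only [explorationRate]
  linarith

lemma klUCBIndex_dQua (h : History K t) {a : Fin K} (ha : 0 < numPulls h a) :
    klUCBIndex dQua explorationRate t h a = ucbIndex t h a := by
  have hN : (0 : ℝ) < numPulls h a := by exact_mod_cast ha
  have hf := one_lt_explorationRate t
  have hs : {m : ℝ | dQua (empMean h a) m ≤ explorationRate t / (numPulls h a : ℝ)} =
      Set.Icc (empMean h a - Real.sqrt (explorationRate t / (2 * (numPulls h a : ℝ))))
        (empMean h a + Real.sqrt (explorationRate t / (2 * (numPulls h a : ℝ)))) := by
    ext m
    have e : explorationRate t / (2 * (numPulls h a : ℝ))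
        = (explorationRate t / (numPulls h a : ℝ)) / 2 := by field_simp
    rw [Set.mem_ofPred_eq, dQua, Set.mem_Icc, ← le_div_iff₀' (by norm_num : (0 : ℝ) < 2), ← e,
      Real.sq_le (by positivity)]
    constructor <;> rintro ⟨h1, h2⟩ <;> constructor <;> linarith
  rw [klUCBIndex, hs, csSup_Icc (by linarith [Real.sqrt_nonneg (explorationRate t / (2 * (numPulls h a : ℝ)))]), ucbIndex]

lemma followsIndex_klUCBIndex_iff (π : Strategy K) :
    π.FollowsIndex (klUCBIndex dQua explorationRate) ↔ π.FollowsIndex ucbIndex := by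
  refine forall₂_congr fun t h => and_congr_right fun _ => forall₂_congr fun _ hpos => ?_
  simp only [klUCBIndex_dQua h (hpos _)]

/-- Makes the sum of `1 / (t log t)` telescope; `log x ≥ 1 - 1/x` is used once for each logarithm.
-/
lemma one_div_mul_log_le {t : ℕ} (ht : 3 ≤ t) :
    1 / ((t + 1 : ℕ) * Real.log (t + 1 : ℕ)) ≤
      Real.log (Real.log (t + 1 : ℕ)) - Real.log (Real.log t) := by
  have h1 := one_lt_log_natCast ht
  have h2 := one_lt_log_natCast (ht.trans t.le_succ)
  have ht0 : (0 : ℝ) < t := by exact_mod_cast (by omega : 0 < t)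
  have ht1 : (0 : ℝ) < (t + 1 : ℕ) := by positivity
  rw [← Real.log_div (by linarith) (by linarith)]
  refine le_trans ?_ (Real.one_sub_inv_le_log_of_pos (by apply div_pos <;> linarith))
  have h3 := Real.one_sub_inv_le_log_of_pos (div_pos ht1 ht0)
  rw [Real.log_div ht1.ne' ht0.ne'] at h3
  have h4 : 1 - ((t + 1 : ℕ) / (t : ℝ))⁻¹ = 1 / (t + 1 : ℕ) := by
    push_cast; field_simp; ring
  rw [h4] at h3
  have hl : 0 < Real.log (t + 1 : ℕ) := by linarith
  rw [one_div, mul_inv, ← one_div, inv_div, ← div_eq_mul_inv, div_le_iff₀ hl]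
  have : (1 - Real.log t / Real.log (t + 1 : ℕ)) * Real.log (t + 1 : ℕ)
      = Real.log (t + 1 : ℕ) - Real.log t := by field_simp
  linarith

/-- With `u = log (t + 1)` and `δ = u + 3 log u`, there are at most `4u²` slices, each of
probability at most `e / ((t + 1) u³)`. The term `3 log log` is what leaves `1 / ((t + 1) u)`. -/
lemma historyLaw_ucbIndex_lt_mean_le (π : Strategy K) {ν : Model K} (hν : ν.RewardsInUnit)
    (a : Fin K) {t : ℕ} (ht : 3 ≤ t) :
    historyLaw π ν (t + 1) {h | 0 < numPulls h a ∧ ucbIndex (t + 1) h a < ν.mean a} ≤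
      ENNReal.ofReal (4 * Real.exp 1 *
        (Real.log (Real.log (t + 1 : ℕ)) - Real.log (Real.log t))) := by
  have hf := one_lt_explorationRate (t + 1)
  refine (historyLaw_ucb_lt_mean_le π hν a (by omega) hf).trans (ENNReal.ofReal_le_ofReal ?_)
  refine le_trans ?_ (mul_le_mul_of_nonneg_left (one_div_mul_log_le ht) (by positivity))
  have hu := one_lt_log_natCast (ht.trans t.le_succ)
  rw [explorationRate_of_le (by omega)] at hf ⊢
  set u := Real.log (t + 1 : ℕ) with hu_def
  have hu0 : 0 < u := by linarith
  have hexp : Real.exp (1 - (u + 3 * Real.log u)) = Real.exp 1 / ((t + 1 : ℕ) * u ^ 3) := by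
    rw [Real.exp_sub, Real.exp_add, hu_def, Real.exp_log (by positivity), ← hu_def]
    congr 2
    rw [show 3 * Real.log u = Real.log (u ^ 3) by rw [Real.log_pow]; norm_num,
      Real.exp_log (by positivity)]
  have hceil : (⌈(u + 3 * Real.log u) * u⌉₊ : ℝ) ≤ 4 * u ^ 2 := by
    refine (Nat.ceil_lt_add_one (by positivity)).le.trans ?_
    have := Real.log_le_sub_one_of_pos hu0
    nlinarith [mul_le_mul_of_nonneg_right this hu0.le]
  rw [hexp]
  calc _ ≤ 4 * u ^ 2 * (Real.exp 1 / ((t + 1 : ℕ) * u ^ 3)) := by gcongr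
    _ = _ := by field_simp

/-- Rounds `0` and `1` do not count because `K ≥ 2`; rounds `2` and `3` are bounded by one each, and
later rounds telescope. -/
lemma sum_historyLaw_ucbIndex_lt_mean_le (hK : 2 ≤ K) (π : Strategy K) {ν : Model K}
    (hν : ν.RewardsInUnit) (a : Fin K) {T : ℕ} (hT : 3 ≤ T) :
    ∑ t ∈ Finset.range (T + 1), (if K ≤ t then
        historyLaw π ν t {h | 0 < numPulls h a ∧ ucbIndex t h a < ν.mean a} else 0) ≤
      ENNReal.ofReal (2 + 4 * Real.exp 1 * Real.log (Real.log T)) := by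
  induction T, hT using Nat.le_induction with
  | base =>
    have h3 := Real.log_pos one_lt_log_three
    refine le_trans (b := ENNReal.ofReal 2) ?_ (ENNReal.ofReal_le_ofReal ?_)
    · simp only [Finset.sum_range_succ, Finset.range_zero, Finset.sum_empty]
      rw [if_neg (by omega), if_neg (by omega), zero_add, zero_add, zero_add,
        show ENNReal.ofReal 2 = 1 + 1 by norm_num]
      refine add_le_add ?_ ?_ <;> split_ifs <;> first | exact prob_le_one | exact zero_le
    · push_cast
      linarith [mul_pos (mul_pos four_pos (Real.exp_pos 1)) h3]
  | succ T hT ih =>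
    rw [Finset.sum_range_succ]
    have h1 := one_lt_log_natCast hT
    have h2 : Real.log (Real.log T) ≤ Real.log (Real.log (T + 1 : ℕ)) :=
      Real.log_le_log (by linarith) (Real.log_le_log (by linarith [show (3 : ℝ) ≤ T by exact_mod_cast hT]) (by push_cast; linarith))
    have h0 := Real.log_pos h1
    calc _ ≤ ENNReal.ofReal (2 + 4 * Real.exp 1 * Real.log (Real.log T)) +
          ENNReal.ofReal (4 * Real.exp 1 *
            (Real.log (Real.log (T + 1 : ℕ)) - Real.log (Real.log T))) := by
          refine add_le_add ih ?_
          split_ifs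
          · exact historyLaw_ucbIndex_lt_mean_le π hν a hT
          · exact zero_le
      _ = _ := by
        rw [← ENNReal.ofReal_add (by positivity)
          (mul_nonneg (by positivity) (by linarith))]
        congr 1; ring

/-! ### Gaussian and geometric tail sums. -/

lemma sum_exp_neg_mul_sq_le {b : ℝ} (hb : 0 < b) (M : ℕ) :
    ∑ i ∈ Finset.range M, Real.exp (-b * ((i + 1 : ℕ) : ℝ) ^ 2) ≤ Real.sqrt (Real.pi / b) / 2 := by
  have hanti : AntitoneOn (fun x : ℝ => Real.exp (-b * x ^ 2)) (Set.Icc 0 (0 + (M : ℝ))) := by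
    intro x hx y hy hxy
    have := pow_le_pow_left₀ hx.1 hxy 2
    exact Real.exp_le_exp.2 (by nlinarith)
  have h := hanti.sum_le_integral
  simp only [zero_add] at h
  refine h.trans ?_
  rw [← integral_gaussian_Ioi, intervalIntegral.integral_of_le (by positivity)]
  exact setIntegral_mono_set (integrable_exp_neg_mul_sq hb).integrableOn
    (ae_of_all _ fun x => (Real.exp_pos _).le) Set.Ioc_subset_Ioi_self.eventuallyLE

lemma sum_exp_neg_mul_le {b : ℝ} (hb : 0 < b) (M : ℕ) :
    ∑ i ∈ Finset.range M, Real.exp (-b * ((i + 1 : ℕ) : ℝ)) ≤ 1 / b := by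
  have hq : Real.exp (-b) < 1 := Real.exp_lt_one_iff.2 (by linarith)
  have hq0 := Real.exp_pos (-b)
  have h1 : Real.exp (-b) / (1 - Real.exp (-b)) ≤ 1 / b := by
    rw [div_le_div_iff₀ (by linarith) hb]
    have h := Real.add_one_le_exp b
    have h' : Real.exp (-b) * Real.exp b = 1 := by rw [← Real.exp_add]; simp
    nlinarith
  refine le_trans ?_ h1
  have he : ∀ i : ℕ, Real.exp (-b * ((i + 1 : ℕ) : ℝ)) = Real.exp (-b) * Real.exp (-b) ^ i := by
    intro i
    rw [← Real.exp_nat_mul, ← Real.exp_add]; push_cast; ring_nf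
  simp only [he]
  rw [← Finset.mul_sum, div_eq_mul_inv, ← tsum_geometric_of_lt_one hq0.le hq]
  gcongr
  exact (summable_geometric_of_lt_one hq0.le hq).sum_le_tsum _ (fun i _ => by positivity)

/-- The number of pulls after which the deviation `Δ` exceeds the confidence radius is `r ^ 2`;
beyond it, the deviation probability is bounded by a Gaussian and a geometric term. -/
lemma exp_deviation_le {r g x j : ℝ} (hr : 0 < r) (hg : 0 < g) (hj : 0 ≤ j) (hx : r ^ 2 + j ≤ x) :
    Real.exp (-(2 * x * (g - r * g / Real.sqrt x) ^ 2)) ≤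
      Real.exp (-(2 * g ^ 2 / (9 * r ^ 2)) * j ^ 2) + Real.exp (-(g ^ 2 / 2) * j) := by
  have hx0 : 0 < x := by nlinarith [sq_pos_of_pos hr]
  set s := Real.sqrt x with hs
  have hs0 : 0 < s := Real.sqrt_pos.2 hx0
  have hs2 : s ^ 2 = x := Real.sq_sqrt hx0.le
  have hrs : r ≤ s := by
    rw [hs]; exact Real.le_sqrt_of_sq_le (by linarith)
  have he : 2 * x * (g - r * g / s) ^ 2 = 2 * g ^ 2 * (s - r) ^ 2 := by
    rw [← hs2]; field_simp
  rw [he]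
  -- Near the threshold `j ≤ (s - r)(s + r) ≤ 3r(s - r)` gives the Gaussian term; beyond it `s - r ≥
  -- s/2` gives `j ≤ 4(s - r)²` and the geometric term.
  by_cases h : s ≤ 2 * r
  · refine le_trans (Real.exp_le_exp.2 ?_) (le_add_of_nonneg_right (Real.exp_pos _).le)
    have hj2 : j ≤ 3 * r * (s - r) := by nlinarith
    have hj3 : j ^ 2 ≤ (3 * r * (s - r)) ^ 2 := pow_le_pow_left₀ hj hj2 2
    have h9 : 2 * g ^ 2 / (9 * r ^ 2) * j ^ 2 ≤ 2 * g ^ 2 / (9 * r ^ 2) * (3 * r * (s - r)) ^ 2 := by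
      gcongr
    have e : 2 * g ^ 2 / (9 * r ^ 2) * (3 * r * (s - r)) ^ 2 = 2 * g ^ 2 * (s - r) ^ 2 := by
      field_simp; ring
    linarith
  · refine le_trans (Real.exp_le_exp.2 ?_) (le_add_of_nonneg_left (Real.exp_pos _).le)
    push Not at h
    have : (s / 2) ^ 2 ≤ (s - r) ^ 2 := pow_le_pow_left₀ (by positivity) (by linarith) 2
    have hj4 : j ≤ 4 * (s - r) ^ 2 := by nlinarith [sq_nonneg r]
    nlinarith [mul_le_mul_of_nonneg_left hj4 (sq_nonneg g)]

lemma sum_exp_deviation_le {f g : ℝ} (hf : 0 < f) (hg : 0 < g) (T : ℕ) :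
    ∑ n ∈ Finset.Ioc ⌈f / (2 * g ^ 2)⌉₊ T,
        Real.exp (-(2 * n * (g - Real.sqrt (f / (2 * n))) ^ 2)) ≤
      2 * Real.sqrt Real.pi / g ^ 2 * Real.sqrt f + 2 / g ^ 2 := by
  set n₀ := ⌈f / (2 * g ^ 2)⌉₊
  set r := Real.sqrt (f / 2) / g with hr
  have hr0 : 0 < r := by positivity
  have hr2 : r ^ 2 = f / (2 * g ^ 2) := by
    rw [hr, div_pow, Real.sq_sqrt (by positivity)]; field_simp
  have hn₀ : r ^ 2 ≤ n₀ := hr2 ▸ Nat.le_ceil _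
  set c := 2 * g ^ 2 / (9 * r ^ 2) with hc
  have hsum : ∑ n ∈ Finset.Ioc n₀ T, Real.exp (-(2 * n * (g - Real.sqrt (f / (2 * n))) ^ 2)) ≤
      ∑ i ∈ Finset.range (T - n₀), (Real.exp (-c * ((i + 1 : ℕ) : ℝ) ^ 2)
        + Real.exp (-(g ^ 2 / 2) * ((i + 1 : ℕ) : ℝ))) := by
    rw [← Finset.Ico_add_one_add_one_eq_Ioc, Finset.sum_Ico_eq_sum_range, Nat.add_sub_add_right]
    refine Finset.sum_le_sum fun i _ => ?_
    have hsq : Real.sqrt (f / (2 * ((n₀ + 1 + i : ℕ) : ℝ))) =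
        r * g / Real.sqrt ((n₀ + 1 + i : ℕ) : ℝ) := by
      rw [hr, div_mul_cancel₀ _ hg.ne', ← Real.sqrt_div (by positivity), div_div]
    rw [hsq]
    refine exp_deviation_le hr0 hg (by positivity) ?_
    push_cast
    linarith
  refine hsum.trans ?_
  rw [Finset.sum_add_distrib]
  refine add_le_add ((sum_exp_neg_mul_sq_le (by positivity) _).trans ?_)
    ((sum_exp_neg_mul_le (by positivity) _).trans (le_of_eq (by field_simp)))
  have e : Real.pi / c = Real.pi * f * (3 / (2 * g ^ 2)) ^ 2 := by
    rw [hc, hr2]; field_simp; ring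
  rw [e, Real.sqrt_mul (by positivity), Real.sqrt_sq (by positivity),
    Real.sqrt_mul Real.pi_pos.le]
  have : 0 ≤ Real.sqrt Real.pi * Real.sqrt f / g ^ 2 := by positivity
  calc _ = 3 / 4 * (Real.sqrt Real.pi * Real.sqrt f / g ^ 2) := by field_simp; ring
    _ ≤ 2 * (Real.sqrt Real.pi * Real.sqrt f / g ^ 2) := by linarith
    _ = _ := by ring

/-! ### The upper bound on the number of suboptimal pulls. -/

lemma exists_mean_eq_bestMean [Nonempty (Fin K)] (ν : Model K) : ∃ s, ν.mean s = ν.bestMean :=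
  exists_eq_ciSup_of_finite

/-- The three reasons to pull the suboptimal arm `a`: it has been pulled few times so far, the
upper-confidence bound of the best arm `s` fails, or the empirical mean of `a` is too large. -/
lemma ae_choose_le {π : Strategy K} (hπ : π.FollowsIndex ucbIndex) (ν : Model K) (a s : Fin K)
    {n₀ : ℕ} (hn₀ : 0 < n₀) {T : ℕ} (ht : t ≤ T) :
    ∀ᵐ h ∂historyLaw π ν t, π.choose t h {a} ≤
      (∑ n ∈ Finset.range (n₀ + 1), π.choose t h {a} * (if numPulls h a = n then 1 else 0)
        + ∑ n ∈ Finset.Ioc n₀ T, π.choose t h {a} * (if numPulls h a = n ∧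
          n * (ν.mean a + (ν.mean s - ν.mean a - Real.sqrt (explorationRate T / (2 * n))))
            ≤ armSum id h a then 1 else 0))
        + (if K ≤ t then
            {h : History K t | 0 < numPulls h s ∧ ucbIndex t h s < ν.mean s}.indicator 1 h
          else 0) := by
  filter_upwards [ae_numPulls_pos ν (fun t h => (hπ t h).1) t] with h hpos
  by_cases hp : π.choose t h {a} = 0
  · simp [hp]
  by_cases hN : numPulls h a ≤ n₀
  · refine le_trans ?_ (le_trans le_self_add le_self_add)
    refine le_trans ?_ (Finset.single_le_sum (fun _ _ => zero_le)
      (Finset.mem_range.2 (Nat.lt_succ_of_le hN)))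
    simp
  push Not at hN
  -- During initialization an arm that can be pulled has count `0`, which excludes a count above
  -- `n₀`.
  have hKt : K ≤ t := by
    by_contra hlt
    have : numPulls h a = 0 := mem_of_choose_eq_one ((hπ t h).1 (by omega)) hp
    omega
  have hall := hpos.2 hKt
  by_cases hfail : ucbIndex t h s < ν.mean s
  · refine le_trans prob_le_one (le_trans ?_ le_add_self)
    simp [hKt, hall s, hfail]
  · refine le_trans ?_ (le_trans le_add_self le_self_add)
    have hmax : ∀ b, ucbIndex t h b ≤ ucbIndex t h a :=
      mem_of_choose_eq_one ((hπ t h).2 hKt hall) hp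
    refine le_trans ?_ (Finset.single_le_sum (fun _ _ => zero_le)
      (Finset.mem_Ioc.2 ⟨hN, (numPulls_le h a).trans ht⟩))
    have hN0 : (0 : ℝ) < numPulls h a := by exact_mod_cast hall a
    have h1 : ν.mean s ≤ armSum id h a / numPulls h a +
        Real.sqrt (explorationRate T / (2 * (numPulls h a : ℝ))) := by
      refine (not_lt.1 hfail).trans ((hmax s).trans ?_)
      rw [ucbIndex, empMean_eq]
      gcongr
      exact explorationRate_mono ht
    have h2 : numPulls h a * (ν.mean a + (ν.mean s - ν.mean a -
        Real.sqrt (explorationRate T / (2 * (numPulls h a : ℝ))))) ≤ armSum id h a := by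
      rw [← le_div_iff₀' hN0]
      linarith
    rw [if_pos ⟨rfl, h2⟩, mul_one]

lemma ofReal_expectedPulls_le (hK : 2 ≤ K) {π : Strategy K} (hπ : π.FollowsIndex ucbIndex)
    {ν : Model K} (hν : ν.RewardsInUnit) {a s : Fin K} (has : ν.mean a < ν.mean s) {T : ℕ}
    (hT : 3 ≤ T) {n₀ : ℕ} (hn₀ : explorationRate T / (2 * (ν.mean s - ν.mean a) ^ 2) ≤ n₀) :
    ENNReal.ofReal (expectedPulls π ν a T) ≤ (n₀ + 1 : ℕ)
      + ∑ n ∈ Finset.Ioc n₀ T, ENNReal.ofReal (Real.exp (-(2 * n *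
          (ν.mean s - ν.mean a - Real.sqrt (explorationRate T / (2 * n))) ^ 2)))
      + ENNReal.ofReal (2 + 4 * Real.exp 1 * Real.log (Real.log T)) := by
  have hf := one_lt_explorationRate T
  have hgap : 0 < ν.mean s - ν.mean a := by linarith
  have hn₀0 : 0 < n₀ := by
    have : (0 : ℝ) < n₀ := lt_of_lt_of_le (by positivity) hn₀
    exact_mod_cast this
  rw [ofReal_expectedPulls]
  have hm1 : ∀ (t n : ℕ), Measurable fun h : History K t =>
      π.choose t h {a} * (if numPulls h a = n then 1 else 0) := fun t n =>
    (measurable_choose π t a).mul (Measurable.ite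
      (measurableSet_eq_fun (measurable_numPulls a) measurable_const) measurable_const
      measurable_const)
  have hm2 : ∀ (t n : ℕ) (c : ℝ), Measurable fun h : History K t =>
      π.choose t h {a} * (if numPulls h a = n ∧ c ≤ armSum id h a then 1 else 0) := fun t n c =>
    (measurable_choose π t a).mul (Measurable.ite
      ((measurableSet_eq_fun (measurable_numPulls a) measurable_const).inter
        (measurableSet_le measurable_const (measurable_armSum measurable_id a))) measurable_const
      measurable_const)
  refine (Finset.sum_le_sum fun t ht => lintegral_mono_ae
    (ae_choose_le hπ ν a s hn₀0 (Finset.mem_range.1 ht).le)).trans ?_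
  -- Additivity requires measurability of the left summand only, so none is needed for the failure
  -- event of the index.
  have hstep : ∀ t, _ = _ := fun t => lintegral_add_left (μ := historyLaw π ν t)
    ((Finset.measurable_sum (Finset.range (n₀ + 1)) fun n _ => hm1 t n).add
      (Finset.measurable_sum (Finset.Ioc n₀ T) fun n _ => hm2 t n
        (n * (ν.mean a + (ν.mean s - ν.mean a - Real.sqrt (explorationRate T / (2 * n)))))))
    (fun h => if K ≤ t then
      {h : History K t | 0 < numPulls h s ∧ ucbIndex t h s < ν.mean s}.indicator 1 h else 0)
  simp only [Pi.add_apply] at hstep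
  simp only [hstep]
  rw [Finset.sum_add_distrib]
  refine add_le_add ?_ ?_
  · simp only [lintegral_add_left (Finset.measurable_sum (Finset.range (n₀ + 1))
      fun n _ => hm1 _ n)]
    rw [Finset.sum_add_distrib]
    refine add_le_add ?_ ?_
    · simp only [lintegral_finsetSum _ fun n _ => hm1 _ n]
      rw [Finset.sum_comm]
      refine (Finset.sum_le_sum fun n _ => sum_lintegral_choose_le_one π ν a n T).trans ?_
      simp
    · simp only [lintegral_finsetSum _ fun n _ => hm2 _ n _]
      rw [Finset.sum_comm]
      refine Finset.sum_le_sum fun n hn => sum_lintegral_choose_deviation_le π hν a n T ?_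
      have hn0 : (n₀ : ℝ) < n := by exact_mod_cast (Finset.mem_Ioc.1 hn).1
      have hn1 : (0 : ℝ) < n := lt_of_le_of_lt (by positivity) hn0
      -- Beyond `n₀` the confidence radius at horizon `T` is at most the gap, so the deviation is
      -- nonnegative.
      rw [sub_nonneg, Real.sqrt_le_left hgap.le, div_le_iff₀ (by positivity)]
      rw [div_le_iff₀ (by positivity)] at hn₀
      nlinarith [sq_pos_of_pos hgap]
  · refine le_trans ?_ (sum_historyLaw_ucbIndex_lt_mean_le hK π hν s hT)
    refine le_trans (Finset.sum_le_sum fun t _ => ?_)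
      (Finset.sum_le_sum_of_subset (Finset.range_subset_range.2 T.le_succ))
    split_ifs
    · exact lintegral_indicator_one_le _
    · simp

/-- The regret bound of the UCB algorithm. -/
lemma expectedPulls_le (hK : 2 ≤ K) {π : Strategy K} (hπ : π.FollowsIndex ucbIndex)
    {ν : Model K} (hν : ν.RewardsInUnit) {a : Fin K} (ha : ν.mean a < ν.bestMean) {T : ℕ}
    (hT : 3 ≤ T) :
    expectedPulls π ν a T ≤
      Real.log T / (2 * ν.gap a ^ 2)
        + 2 * Real.sqrt Real.pi / ν.gap a ^ 2
            * Real.sqrt (Real.log T + 3 * Real.log (Real.log T))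
        + (4 * Real.exp 1 + 3 / (2 * ν.gap a ^ 2)) * Real.log (Real.log T)
        + 8 / ν.gap a ^ 2 + 6 := by
  have : Nonempty (Fin K) := ⟨a⟩
  obtain ⟨s, hs⟩ := exists_mean_eq_bestMean ν
  have hg : ν.gap a = ν.mean s - ν.mean a := by rw [Model.gap, hs]
  have hg0 : 0 < ν.gap a := sub_pos.2 ha
  have hll := Real.log_pos (one_lt_log_natCast hT)
  have hf := one_lt_explorationRate T
  have h := ofReal_expectedPulls_le hK hπ hν (hs ▸ ha) hT (Nat.le_ceil _)
  rw [← hg] at h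
  rw [← ENNReal.ofReal_sum_of_nonneg fun n _ => (Real.exp_pos _).le, ← ENNReal.ofReal_natCast,
    ← ENNReal.ofReal_add (by positivity) (Finset.sum_nonneg fun n _ => (Real.exp_pos _).le),
    ← ENNReal.ofReal_add (add_nonneg (by positivity)
      (Finset.sum_nonneg fun n _ => (Real.exp_pos _).le)) (by positivity),
    ENNReal.ofReal_le_ofReal_iff (add_nonneg (add_nonneg (by positivity)
      (Finset.sum_nonneg fun n _ => (Real.exp_pos _).le)) (by positivity))] at h
  have htail := sum_exp_deviation_le (f := explorationRate T) (by linarith) hg0 T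
  -- The additive constants total `4`: one from the ceiling, one from the count `0`, two from the
  -- early failures. The stated `6` and `8 / Δ²` leave slack.
  have hceil := Nat.ceil_lt_add_one (show 0 ≤ explorationRate T / (2 * ν.gap a ^ 2) by positivity)
  have h8 : 2 / ν.gap a ^ 2 ≤ 8 / ν.gap a ^ 2 := by gcongr; norm_num
  rw [explorationRate_of_le hT] at *
  push_cast at h
  have e : (Real.log T + 3 * Real.log (Real.log T)) / (2 * ν.gap a ^ 2) =
      Real.log T / (2 * ν.gap a ^ 2) + 3 / (2 * ν.gap a ^ 2) * Real.log (Real.log T) := by ring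
  linarith

/-! ### Change of measure and the Bretagnolle-Huber inequality. -/

/-- Change of measure between two bandit problems that differ only in the law of arm `a`. -/
lemma lintegral_historyLaw_change (π : Strategy K) {ν ν' : Model K} {a : Fin K} {l : ℝ → ℝ}
    (hl : Measurable l) (hne : ∀ b, b ≠ a → ν'.arm b = ν.arm b)
    (ha : ∀ F : ℝ → ENNReal, Measurable F →
      ∫⁻ y, F y ∂ν'.arm a = ∫⁻ y, ENNReal.ofReal (Real.exp (l y)) * F y ∂ν.arm a)
    (T : ℕ) {F : History K T → ENNReal} (hF : Measurable F) :
    ∫⁻ h, F h ∂historyLaw π ν' T =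
      ∫⁻ h, ENNReal.ofReal (Real.exp (armSum l h a)) * F h ∂historyLaw π ν T := by
  have hW : ∀ t, Measurable fun h : History K t => ENNReal.ofReal (Real.exp (armSum l h a)) :=
    fun t => ENNReal.measurable_ofReal.comp (Real.measurable_exp.comp (measurable_armSum hl a))
  induction T with
  | zero =>
    have hWF : Measurable fun h : History K 0 =>
        ENNReal.ofReal (Real.exp (armSum l h a)) * F h := (hW 0).mul hF
    rw [historyLaw, historyLaw, lintegral_dirac' _ hF, lintegral_dirac' _ hWF]
    simp [armSum]
  | succ T ih =>
    have hsn : ∀ b, Measurable fun p : History K T × ℝ => p.1.snoc b p.2 := fun b =>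
      measurable_historySnoc.comp
        (by fun_prop : Measurable fun p : History K T × ℝ => ((p.1, b), p.2))
    have hG : Measurable fun h : History K T =>
        ∑ b, π.choose T h {b} * ∫⁻ y, F (h.snoc b y) ∂ν'.arm b :=
      Finset.measurable_sum _ fun b _ => (measurable_choose π T b).mul
        (hF.comp (hsn b)).lintegral_prod_right'
    have hWF : Measurable fun h : History K (T + 1) =>
        ENNReal.ofReal (Real.exp (armSum l h a)) * F h := (hW (T + 1)).mul hF
    rw [lintegral_historyLaw_succ π ν' hF, ih hG, lintegral_historyLaw_succ π ν hWF]
    refine lintegral_congr fun h => ?_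
    rw [Finset.mul_sum]
    refine Finset.sum_congr rfl fun b _ => ?_
    -- The choice kernel is the same in both problems and cancels; only rewards of `a` enter the
    -- likelihood ratio.
    rw [mul_left_comm]
    congr 1
    have hFy : Measurable fun y => F (h.snoc b y) :=
      (hF.comp (hsn b)).comp measurable_prodMk_left
    simp only [armSum_snoc]
    by_cases hb : b = a
    · subst hb
      simp only [if_true, Real.exp_add, ENNReal.ofReal_mul (Real.exp_pos _).le, mul_assoc]
      rw [lintegral_const_mul _ (by fun_prop), ha _ hFy]
    · simp only [hb, if_false, add_zero]
      rw [lintegral_const_mul _ hFy, hne b hb]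

lemma abs_armSum_le {l : ℝ → ℝ} {C : ℝ} (hC : ∀ y, |l y| ≤ C) (h : History K t) (a : Fin K) :
    |armSum l h a| ≤ t * C := by
  have hC0 : 0 ≤ C := (abs_nonneg _).trans (hC 0)
  calc |armSum l h a| ≤ ∑ s with (h s).1 = a, |l (h s).2| := Finset.abs_sum_le_sum_abs _ _
    _ ≤ ∑ s with (h s).1 = a, C := Finset.sum_le_sum fun s _ => hC _
    _ = numPulls h a * C := by rw [Finset.sum_const, nsmul_eq_mul]; rfl
    _ ≤ t * C := by gcongr; exact numPulls_le h a

/-- Wald's identity for bounded functions of the rewards. -/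
lemma integral_armSum (π : Strategy K) (ν : Model K) (a : Fin K) {l : ℝ → ℝ} (hl : Measurable l)
    {C : ℝ} (hC : ∀ y, |l y| ≤ C) (T : ℕ) :
    ∫ h, armSum l h a ∂historyLaw π ν T = expectedPulls π ν a T * ∫ y, l y ∂ν.arm a := by
  -- Shifting by `C` reduces to the nonnegative Wald identity.
  have hpos : ∀ y, 0 ≤ l y + C := fun y => by linarith [(abs_le.1 (hC y)).1]
  have hli : Integrable l (ν.arm a) :=
    Integrable.of_bound hl.aestronglyMeasurable C (ae_of_all _ hC)
  have hsi : Integrable (fun h => armSum l h a) (historyLaw π ν T) :=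
    Integrable.of_bound (measurable_armSum hl a).aestronglyMeasurable (T * C)
      (ae_of_all _ fun h => abs_armSum_le hC h a)
  have hadd : ∀ h : History K T,
      armSum (fun y => l y + C) h a = armSum l h a + numPulls h a * C := fun h => by
    rw [← armSum_const, armSum, armSum, armSum, Finset.sum_add_distrib]
  have h1 : ∫ h, armSum (fun y => l y + C) h a ∂historyLaw π ν T =
      expectedPulls π ν a T * ∫ y, (l y + C) ∂ν.arm a := by
    have hpos' : ∀ h : History K T, 0 ≤ armSum (fun y => l y + C) h a := fun h =>
      Finset.sum_nonneg fun s _ => hpos _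
    rw [integral_eq_lintegral_of_nonneg_ae (ae_of_all _ hpos')
        (measurable_armSum (hl.add_const C) a).aestronglyMeasurable,
      integral_eq_lintegral_of_nonneg_ae (ae_of_all _ hpos)
        (hl.add_const C).aestronglyMeasurable,
      ← ENNReal.toReal_ofReal (expectedPulls_nonneg π ν a T), ← ENNReal.toReal_mul,
      ofReal_expectedPulls, ← lintegral_armSum π ν a (by fun_prop)]
    congr 1
    refine lintegral_congr fun h => ?_
    rw [armSum, ENNReal.ofReal_sum_of_nonneg fun s _ => hpos _]
    rfl
  simp only [hadd] at h1
  rw [integral_add hsi ((integrable_numPulls π ν a T).mul_const C), integral_mul_const,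
    integral_add hli (integrable_const C), integral_const, ← expectedPulls] at h1
  simp only [probReal_univ, smul_eq_mul, one_mul] at h1
  linarith

/-- The Bretagnolle-Huber inequality for the laws of the histories. -/
lemma exp_neg_divergence_le (π : Strategy K) {ν ν' : Model K} {a : Fin K} {l : ℝ → ℝ}
    (hl : Measurable l) {C : ℝ} (hC : ∀ y, |l y| ≤ C) (hne : ∀ b, b ≠ a → ν'.arm b = ν.arm b)
    (ha : ∀ F : ℝ → ENNReal, Measurable F →
      ∫⁻ y, F y ∂ν'.arm a = ∫⁻ y, ENNReal.ofReal (Real.exp (l y)) * F y ∂ν.arm a)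
    (T : ℕ) {A : Set (History K T)} (hA : MeasurableSet A) :
    Real.exp (expectedPulls π ν a T * ∫ y, l y ∂ν.arm a) ≤
      2 * ((historyLaw π ν T).real Aᶜ + (historyLaw π ν' T).real A) := by
  set P := historyLaw π ν T
  set Z : History K T → ℝ := fun h => armSum l h a with hZ
  have hZm : Measurable Z := measurable_armSum hl a
  have hZb : ∀ h, |Z h| ≤ T * C := fun h => abs_armSum_le hC h a
  have hZi : Integrable Z P :=
    Integrable.of_bound hZm.aestronglyMeasurable (T * C) (ae_of_all _ hZb)
  have hEi : Integrable (fun h => Real.exp (Z h)) P := by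
    refine Integrable.of_bound (by fun_prop) (Real.exp (T * C)) (ae_of_all _ fun h => ?_)
    rw [Real.norm_eq_abs, Real.abs_exp, Real.exp_le_exp]
    exact (abs_le.1 (hZb h)).2
  have hHi : Integrable (fun h => Real.exp (Z h / 2)) P := by
    refine Integrable.of_bound (by fun_prop) (Real.exp (T * C / 2)) (ae_of_all _ fun h => ?_)
    rw [Real.norm_eq_abs, Real.abs_exp, Real.exp_le_exp]
    linarith [(abs_le.1 (hZb h)).2]
  have hreal : ∀ B : Set (History K T), MeasurableSet B →
      (historyLaw π ν' T).real B = ∫ h, B.indicator (fun h => Real.exp (Z h)) h ∂P := by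
    intro B hB
    rw [integral_eq_lintegral_of_nonneg_ae
      (ae_of_all _ fun h => Set.indicator_nonneg (fun _ _ => (Real.exp_pos _).le) h)
      (hEi.aestronglyMeasurable.indicator hB), Measure.real, ← lintegral_indicator_one hB,
      lintegral_historyLaw_change π hl hne ha T (measurable_one.indicator hB)]
    congr 1
    refine lintegral_congr fun h => ?_
    by_cases hh : h ∈ B <;> simp [hh, hZ]
  have hone : ∫ h, Real.exp (Z h) ∂P = 1 := by
    have := hreal Set.univ MeasurableSet.univ
    rw [probReal_univ] at this
    simpa using this.symm
  set m := expectedPulls π ν a T * ∫ y, l y ∂ν.arm a with hm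
  have hZm' : ∫ h, Z h ∂P = m := integral_armSum π ν a hl hC T
  set x := Real.exp (m / 2) with hx
  have hx0 : 0 < x := Real.exp_pos _
  -- Jensen's inequality, through the tangent line of `exp` at `m / 2`.
  have hlow : x ≤ ∫ h, Real.exp (Z h / 2) ∂P := by
    have h1 : ∀ h, x * (1 + (Z h / 2 - m / 2)) ≤ Real.exp (Z h / 2) := fun h => by
      rw [show Z h / 2 = m / 2 + (Z h / 2 - m / 2) by ring, Real.exp_add, ← hx]
      gcongr
      linarith [Real.add_one_le_exp (Z h / 2 - m / 2)]
    have hi2 : Integrable (fun h => Z h / 2 - m / 2) P := (hZi.div_const 2).sub (integrable_const _)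
    have hi : Integrable (fun h => x * (1 + (Z h / 2 - m / 2))) P :=
      ((integrable_const _).add hi2).const_mul x
    have h2 := integral_mono hi hHi h1
    rw [integral_const_mul, integral_add (integrable_const _) hi2,
      integral_sub (hZi.div_const 2) (integrable_const _), integral_div, hZm'] at h2
    simpa using h2
  have hup : ∫ h, Real.exp (Z h / 2) ∂P ≤
      1 / x * (P.real Aᶜ + (historyLaw π ν' T).real A) + x / 2 := by
    -- A pointwise AM-GM bound in place of Cauchy-Schwarz: `u ≤ u²/x + x/4` on `A` and `u ≤ 1/x + x
    -- u²/4` off `A`.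
    have h1 : ∀ h, Real.exp (Z h / 2) ≤ 1 / x * (Aᶜ.indicator 1 h +
        A.indicator (fun h => Real.exp (Z h)) h) + x / 4 * (1 + Real.exp (Z h)) := fun h => by
      have hu : Real.exp (Z h) = Real.exp (Z h / 2) ^ 2 := by
        rw [← Real.exp_nat_mul]; ring_nf
      set u := Real.exp (Z h / 2)
      have hu0 : 0 < u := Real.exp_pos _
      by_cases hh : h ∈ A
      · simp only [hh, Set.mem_compl_iff, not_true_eq_false, not_false_eq_true,
          Set.indicator_of_notMem, Set.indicator_of_mem, hu]
        have : 1 / x * (0 + u ^ 2) + x / 4 * (1 + u ^ 2) - u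
          = (u - x / 2) ^ 2 / x + x / 4 * u ^ 2 := by field_simp; ring
        have : 0 ≤ (u - x / 2) ^ 2 / x + x / 4 * u ^ 2 := by positivity
        linarith
      · simp only [hh, Set.mem_compl_iff, not_false_eq_true,
          Set.indicator_of_notMem, Set.indicator_of_mem, hu, Pi.one_apply]
        have : 1 / x * (1 + 0) + x / 4 * (1 + u ^ 2) - u
          = (1 - x * u / 2) ^ 2 / x + x / 4 := by field_simp; ring
        have : 0 ≤ (1 - x * u / 2) ^ 2 / x + x / 4 := by positivity
        linarith
    have hiA : Integrable (Aᶜ.indicator (1 : History K T → ℝ)) P :=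
      (integrable_const (1 : ℝ)).indicator hA.compl
    have hiA' : Integrable (A.indicator fun h => Real.exp (Z h)) P := hEi.indicator hA
    have hi1 : Integrable (fun h => 1 / x * (Aᶜ.indicator 1 h +
        A.indicator (fun h => Real.exp (Z h)) h)) P := (hiA.add hiA').const_mul _
    have hi2 : Integrable (fun h => x / 4 * (1 + Real.exp (Z h))) P :=
      ((integrable_const _).add hEi).const_mul _
    refine (integral_mono hHi (hi1.add hi2) h1).trans (le_of_eq ?_)
    simp only [Pi.add_apply]
    rw [integral_add hi1 hi2, integral_const_mul, integral_const_mul, integral_add hiA hiA',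
      integral_add (integrable_const _) hEi, hone, ← hreal A hA, integral_indicator_one hA.compl,
      integral_const]
    simp only [probReal_univ, smul_eq_mul, one_mul]
    ring
  have hxx : x * x = Real.exp m := by rw [hx, ← Real.exp_add]; ring_nf
  have hfin : x / 2 ≤ (P.real Aᶜ + (historyLaw π ν' T).real A) / x := by
    have := hlow.trans hup
    rw [one_div_mul_eq_div] at this
    linarith
  rw [le_div_iff₀ hx0] at hfin
  linarith

/-! ### Bernoulli problems and the lower bound. -/

/-- The Bernoulli distribution on `ℝ`. -/
noncomputable def bernoulliLaw (p : ℝ) : Measure ℝ :=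
  ENNReal.ofReal (1 - p) • Measure.dirac 0 + ENNReal.ofReal p • Measure.dirac 1

lemma lintegral_bernoulliLaw (p : ℝ) (F : ℝ → ENNReal) :
    ∫⁻ y, F y ∂bernoulliLaw p = ENNReal.ofReal (1 - p) * F 0 + ENNReal.ofReal p * F 1 := by
  simp [bernoulliLaw, lintegral_add_measure, lintegral_smul_measure, lintegral_dirac]

lemma integral_bernoulliLaw {p : ℝ} (hp : p ∈ Set.Icc (0 : ℝ) 1) (F : ℝ → ℝ) :
    ∫ y, F y ∂bernoulliLaw p = (1 - p) * F 0 + p * F 1 := by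
  have hi : ∀ (c x : ℝ), Integrable F (ENNReal.ofReal c • Measure.dirac x) := fun c x =>
    (integrable_dirac (by simp)).smul_measure ENNReal.ofReal_ne_top
  rw [bernoulliLaw, integral_add_measure (hi _ _) (hi _ _), integral_smul_measure,
    integral_smul_measure, integral_dirac, integral_dirac, ENNReal.toReal_ofReal hp.1,
    ENNReal.toReal_ofReal (by linarith [hp.2])]
  rfl

/-- The bandit problem with Bernoulli rewards. -/
noncomputable def bernoulliModel (p : Fin K → ℝ) (hp : ∀ a, p a ∈ Set.Icc (0 : ℝ) 1) : Model K where
  arm a := bernoulliLaw (p a)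
  isProb a := ⟨by
    rw [← lintegral_one, lintegral_bernoulliLaw, mul_one, mul_one,
      ← ENNReal.ofReal_add (by linarith [(hp a).2]) (hp a).1]
    simp⟩

variable {p : Fin K → ℝ} {hp : ∀ a, p a ∈ Set.Icc (0 : ℝ) 1}

lemma bernoulliModel_rewardsInUnit : (bernoulliModel p hp).RewardsInUnit := by
  intro a
  change ∀ᵐ y ∂bernoulliLaw (p a), _
  rw [bernoulliLaw, ae_add_measure_iff]
  exact ⟨Measure.ae_smul_measure ((ae_dirac_iff (p := (· ∈ Set.Icc (0 : ℝ) 1)) measurableSet_Icc).2 (by simp)) _,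
    Measure.ae_smul_measure ((ae_dirac_iff (p := (· ∈ Set.Icc (0 : ℝ) 1)) measurableSet_Icc).2 (by simp)) _⟩

lemma bernoulliModel_mean (a : Fin K) : (bernoulliModel p hp).mean a = p a :=
  (integral_bernoulliLaw (hp a) _).trans (by simp)

lemma bernoulliModel_bestMean {a : Fin K} (ha : ∀ b, p b ≤ p a) :
    (bernoulliModel p hp).bestMean = p a := by
  have : Nonempty (Fin K) := ⟨a⟩
  rw [Model.bestMean]
  simp only [bernoulliModel_mean]
  exact le_antisymm (ciSup_le ha) (le_ciSup (Set.finite_range p).bddAbove a)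

lemma expectedPulls_markov (π : Strategy K) (ν : Model K) (a : Fin K) {T : ℕ} (hT : 0 < T) :
    (historyLaw π ν T).real {h | 2 * numPulls h a ≤ T}ᶜ ≤ 2 / T * expectedPulls π ν a T := by
  have hm := mul_meas_ge_le_integral_of_nonneg (μ := historyLaw π ν T)
    (ae_of_all _ fun h => by positivity) (integrable_numPulls π ν a T) ((T : ℝ) / 2)
  have hsub : {h : History K T | 2 * numPulls h a ≤ T}ᶜ ⊆ {h | (T : ℝ) / 2 ≤ numPulls h a} := by
    intro h hh
    simp only [Set.mem_compl_iff, Set.mem_ofPred_eq, not_le] at hh ⊢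
    have : (T : ℝ) < 2 * numPulls h a := by exact_mod_cast hh
    linarith
  refine (measureReal_mono hsub).trans ?_
  have hT0 : (0 : ℝ) < T := by exact_mod_cast hT
  rw [div_mul_eq_mul_div, le_div_iff₀ hT0, expectedPulls]
  linarith

/-- If `a` takes at most half of the rounds, the other arms take at least half; Markov's inequality
applies to their total. -/
lemma expectedPulls_markov_others (π : Strategy K) (ν : Model K) (a : Fin K) {T : ℕ}
    (hT : 0 < T) :
    (historyLaw π ν T).real {h | 2 * numPulls h a ≤ T} ≤
      2 / T * ∑ b ∈ Finset.univ.erase a, expectedPulls π ν b T := by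
  have hm := mul_meas_ge_le_integral_of_nonneg (μ := historyLaw π ν T)
    (f := fun h => ∑ b ∈ Finset.univ.erase a, (numPulls h b : ℝ))
    (ae_of_all _ fun h => by positivity)
    (integrable_finsetSum _ fun b _ => integrable_numPulls π ν b T) ((T : ℝ) / 2)
  rw [integral_finsetSum _ fun b _ => integrable_numPulls π ν b T] at hm
  have hsub : {h : History K T | 2 * numPulls h a ≤ T} ⊆
      {h | (T : ℝ) / 2 ≤ ∑ b ∈ Finset.univ.erase a, (numPulls h b : ℝ)} := by
    intro h hh
    simp only [Set.mem_ofPred_eq] at hh ⊢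
    have h1 : (2 * numPulls h a : ℝ) ≤ T := by exact_mod_cast hh
    have h2 : ∑ b ∈ Finset.univ.erase a, (numPulls h b : ℝ) + numPulls h a = T := by
      rw [Finset.sum_erase_add _ _ (Finset.mem_univ a)]
      exact_mod_cast sum_numPulls h
    linarith
  refine (measureReal_mono hsub).trans ?_
  have hT0 : (0 : ℝ) < T := by exact_mod_cast hT
  rw [div_mul_eq_mul_div, le_div_iff₀ hT0]
  simp only [expectedPulls]
  linarith

/-- The logarithm of the likelihood ratio of the Bernoulli distributions with expectations
`1 / 2 + D` and `1 / 2`. -/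
noncomputable def bernoulliLogRatio (D y : ℝ) : ℝ :=
  if y = 1 then Real.log (1 + 2 * D) else Real.log (1 - 2 * D)

lemma measurable_bernoulliLogRatio (D : ℝ) : Measurable (bernoulliLogRatio D) :=
  Measurable.ite (measurableSet_singleton 1) measurable_const measurable_const

lemma abs_bernoulliLogRatio_le (D y : ℝ) :
    |bernoulliLogRatio D y| ≤ max |Real.log (1 + 2 * D)| |Real.log (1 - 2 * D)| := by
  rw [bernoulliLogRatio]
  split_ifs
  · exact le_max_left _ _
  · exact le_max_right _ _

lemma lintegral_bernoulliLaw_half_add {D : ℝ} (hD0 : 0 < D) (hD : D < 1 / 2) (F : ℝ → ENNReal) :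
    ∫⁻ y, F y ∂bernoulliLaw (1 / 2 + D) =
      ∫⁻ y, ENNReal.ofReal (Real.exp (bernoulliLogRatio D y)) * F y ∂bernoulliLaw (1 / 2) := by
  rw [lintegral_bernoulliLaw, lintegral_bernoulliLaw, ← mul_assoc, ← mul_assoc,
    ← ENNReal.ofReal_mul (by norm_num), ← ENNReal.ofReal_mul (by norm_num)]
  simp only [bernoulliLogRatio, if_true, zero_ne_one, if_false]
  rw [Real.exp_log (by linarith), Real.exp_log (by linarith)]
  ring_nf

/-- The divergence equals `-log (1 - 4D²) / 2`. Being about `2D²` for small `D`, it is where the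
constant `1/2` comes from. -/
lemma neg_integral_bernoulliLogRatio_le {D : ℝ} (hD0 : 0 < D) (hD : D < 1 / 2) :
    -∫ y, bernoulliLogRatio D y ∂bernoulliLaw (1 / 2) ≤ 2 * D ^ 2 / (1 - 4 * D ^ 2) := by
  have hpos : 0 < 1 - 4 * D ^ 2 := by nlinarith
  rw [integral_bernoulliLaw (by norm_num)]
  simp only [bernoulliLogRatio, if_true, zero_ne_one, if_false]
  have h1 : Real.log (1 - 2 * D) + Real.log (1 + 2 * D) = Real.log (1 - 4 * D ^ 2) := by
    rw [← Real.log_mul (by linarith) (by linarith)]; ring_nf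
  have h2 := Real.one_sub_inv_le_log_of_pos hpos
  have h3 : 2 * D ^ 2 / (1 - 4 * D ^ 2) = -(1 - (1 - 4 * D ^ 2)⁻¹) / 2 := by
    rw [div_eq_iff hpos.ne']
    linear_combination -(1 / 2) * inv_mul_cancel₀ hpos.ne'
  rw [h3]
  linarith

/-- At `δ = 0` the last inequality reads `2c < 1`, so continuity suffices. The excess `δ²` puts the
raised arm strictly above the former best one. -/
lemma exists_small_gap {c : ℝ} (hc : c < 1 / 2) :
    ∃ δ : ℝ, 0 < δ ∧ δ + δ ^ 2 < 1 / 2 ∧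
      2 * c * (1 + δ) ^ 2 < 1 - 4 * (δ + δ ^ 2) ^ 2 := by
  have h1 : ContinuousAt (fun δ : ℝ => δ + δ ^ 2) 0 := by fun_prop
  have h2 : ContinuousAt (fun δ : ℝ => 1 - 4 * (δ + δ ^ 2) ^ 2 - 2 * c * (1 + δ) ^ 2) 0 := by
    fun_prop
  have e1 := h1.eventually_lt_const (u := 1 / 2) (by norm_num)
  have e2 := h2.eventually_const_lt (u := 0) (by norm_num; linarith)
  have e := ((e1.and e2).filter_mono (nhdsWithin_le_nhds (s := Set.Ioi 0))).and
    self_mem_nhdsWithin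
  obtain ⟨δ, ⟨h1, h2⟩, h3⟩ := e.exists
  exact ⟨δ, h3, h1, by linarith⟩

/-- No power of `T` is dominated by its logarithm. -/
lemma not_eventually_rpow_neg_le {θ C : ℝ} (hθ : θ < 1) (hC : 0 ≤ C) :
    ¬ ∀ᶠ T : ℕ in atTop, Real.exp (-(θ * Real.log T)) ≤ C * Real.log T / T := by
  intro h
  have ho := ((isLittleO_log_rpow_atTop (r := 1 - θ) (by linarith)).comp_tendsto
    tendsto_natCast_atTop_atTop).bound (c := 1 / (C + 1)) (by positivity)
  obtain ⟨T, ⟨h1, h2⟩, hT⟩ := ((h.and ho).and (eventually_ge_atTop 3)).exists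
  have hT0 : (0 : ℝ) < T := by exact_mod_cast (by omega : 0 < T)
  have hlog : 0 < Real.log T := by linarith [one_lt_log_natCast hT]
  simp only [Function.comp_apply, Real.norm_eq_abs] at h2
  rw [abs_of_pos hlog, abs_of_pos (Real.rpow_pos_of_pos hT0 _), one_div_mul_eq_div,
    le_div_iff₀ (by positivity)] at h2
  have e : Real.exp (-(θ * Real.log T)) = (T : ℝ) ^ (1 - θ) / T := by
    rw [Real.rpow_def_of_pos hT0, eq_div_iff hT0.ne']
    nth_rewrite 2 [← Real.exp_log hT0]
    rw [← Real.exp_add]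
    ring_nf
  rw [e, div_le_div_iff_of_pos_right hT0] at h1
  linarith

/-- Lower bound of Lai and Robbins type: no strategy improves on the constant `1 / 2`. -/
lemma exists_frequently_lt_expectedPulls (hK : 2 ≤ K) {c : ℝ} (hc : c < 1 / 2)
    (π : Strategy K) :
    ∃ ν : Model K, ν.RewardsInUnit ∧ ∃ a : Fin K, ν.mean a < ν.bestMean ∧
      ∃ᶠ T : ℕ in atTop, c * Real.log T / ν.gap a ^ 2 < expectedPulls π ν a T := by
  wlog hc0 : 0 ≤ c generalizing c
  · obtain ⟨ν, hν, a, ha, hf⟩ := this (c := 0) (by norm_num) le_rfl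
    refine ⟨ν, hν, a, ha, hf.mono fun T hT => lt_of_le_of_lt ?_ hT⟩
    have := Real.log_natCast_nonneg T
    gcongr
    exact (not_le.1 hc0).le
  by_contra hcon
  have H : ∀ ν : Model K, ν.RewardsInUnit → ∀ a, ν.mean a < ν.bestMean →
      ∀ᶠ T : ℕ in atTop, expectedPulls π ν a T ≤ c * Real.log T / ν.gap a ^ 2 := by
    intro ν hν a ha
    by_contra hne
    refine hcon ⟨ν, hν, a, ha, ?_⟩
    simpa only [not_eventually, not_le] using hne
  obtain ⟨δ, hδ, hD, hcδ⟩ := exists_small_gap hc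
  set D := δ + δ ^ 2 with hD_def
  have hδ2 : 0 < δ ^ 2 := by positivity
  have hD0 : 0 < D := by positivity
  let i₀ : Fin K := ⟨0, by omega⟩
  let i₁ : Fin K := ⟨1, by omega⟩
  have hi : i₀ ≠ i₁ := by simp [i₀, i₁]
  let p : Fin K → ℝ := fun b => if b = i₀ then 1 / 2 + δ else 1 / 2
  -- Raising `i₁` alone makes it the unique best arm, and every other arm suboptimal.
  let p' : Fin K → ℝ := Function.update p i₁ (1 / 2 + D)
  have hp : ∀ b, p b ∈ Set.Icc (0 : ℝ) 1 := fun b => by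
    simp only [p, Set.mem_Icc]; split_ifs <;> constructor <;> linarith
  have hp' : ∀ b, p' b ∈ Set.Icc (0 : ℝ) 1 := fun b => by
    by_cases hb : b = i₁
    · subst hb
      simp only [p', Function.update_self, Set.mem_Icc]; constructor <;> linarith
    · simp only [p', Function.update_of_ne hb]; exact hp b
  have hp1 : p i₁ = 1 / 2 := if_neg hi.symm
  have hple : ∀ b, p b ≤ 1 / 2 + δ := fun b => by
    simp only [p]; split_ifs <;> linarith
  have hbest : (bernoulliModel p hp).bestMean = 1 / 2 + δ :=
    (bernoulliModel_bestMean (a := i₀) fun b => by simpa [p] using hple b).trans (if_pos rfl)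
  have hp'1 : p' i₁ = 1 / 2 + D := Function.update_self ..
  have hp'lt : ∀ b, b ≠ i₁ → p' b < 1 / 2 + D := fun b hb => by
    simp only [p', Function.update_of_ne hb]
    linarith [hple b]
  have hbest' : (bernoulliModel p' hp').bestMean = 1 / 2 + D := by
    rw [← hp'1]
    refine bernoulliModel_bestMean fun b => ?_
    rw [hp'1]
    by_cases hb : b = i₁
    · rw [hb, hp'1]
    · exact (hp'lt b hb).le
  have hgap : (bernoulliModel p hp).gap i₁ = δ := by
    rw [Model.gap, hbest, bernoulliModel_mean, hp1]; ring
  have hev := H _ (bernoulliModel_rewardsInUnit (hp := hp)) i₁ (by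
    rw [hbest, bernoulliModel_mean, hp1]; linarith)
  rw [hgap] at hev
  have hev' : ∀ᶠ T : ℕ in atTop, ∀ b ∈ Finset.univ.erase i₁,
      expectedPulls π (bernoulliModel p' hp') b T ≤
        c * Real.log T / (bernoulliModel p' hp').gap b ^ 2 := by
    rw [Finset.eventually_all]
    intro b hb
    refine H _ (bernoulliModel_rewardsInUnit (hp := hp')) b ?_
    rw [hbest', bernoulliModel_mean]
    exact hp'lt b (Finset.ne_of_mem_erase hb)
  set k := -∫ y, bernoulliLogRatio D y ∂bernoulliLaw (1 / 2) with hk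
  have hkle : k ≤ 2 * D ^ 2 / (1 - 4 * D ^ 2) := neg_integral_bernoulliLogRatio_le hD0 hD
  -- Using `max k 0` avoids proving that the divergence `k` is nonnegative.
  have hk' : max k 0 ≤ 2 * D ^ 2 / (1 - 4 * D ^ 2) := max_le hkle
    (div_nonneg (by positivity) (by nlinarith))
  have hθ : max k 0 * (c / δ ^ 2) < 1 := by
    have hpos : 0 < 1 - 4 * D ^ 2 := by nlinarith
    calc max k 0 * (c / δ ^ 2) ≤ 2 * D ^ 2 / (1 - 4 * D ^ 2) * (c / δ ^ 2) := by gcongr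
      _ = 2 * c * (1 + δ) ^ 2 / (1 - 4 * D ^ 2) := by
        rw [show D ^ 2 = δ ^ 2 * (1 + δ) ^ 2 by rw [hD_def]; ring] at hpos ⊢
        field_simp
      _ < 1 := (div_lt_one hpos).2 hcδ
  set C := c / δ ^ 2 + ∑ b ∈ Finset.univ.erase i₁, c / (bernoulliModel p' hp').gap b ^ 2 with hC
  have hC0 : 0 ≤ C := by positivity
  refine not_eventually_rpow_neg_le hθ (mul_nonneg four_pos.le hC0) ?_
  filter_upwards [hev, hev', eventually_ge_atTop 3] with T hT hT' hT3
  have hlog : 0 < Real.log T := by linarith [one_lt_log_natCast hT3]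
  have hA : MeasurableSet {h : History K T | 2 * numPulls h i₁ ≤ T} :=
    measurableSet_le ((measurable_numPulls i₁).const_mul 2) measurable_const
  have hBH := exp_neg_divergence_le π (ν := bernoulliModel p hp) (ν' := bernoulliModel p' hp')
    (a := i₁) (measurable_bernoulliLogRatio D) (abs_bernoulliLogRatio_le D)
    (fun b hb => by simp only [bernoulliModel, p', Function.update_of_ne hb])
    (fun F _ => by
      simp only [bernoulliModel, hp1, hp'1]
      exact lintegral_bernoulliLaw_half_add hD0 hD F) T hA
  have hint : ∫ y, bernoulliLogRatio D y ∂(bernoulliModel p hp).arm i₁ = -k := by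
    simp only [bernoulliModel, hp1, hk, neg_neg]
  rw [hint] at hBH
  have hm1 := expectedPulls_markov π (bernoulliModel p hp) i₁ (T := T) (by omega)
  have hm2 := expectedPulls_markov_others π (bernoulliModel p' hp') i₁ (T := T) (by omega)
  have hsum : expectedPulls π (bernoulliModel p hp) i₁ T
      + ∑ b ∈ Finset.univ.erase i₁, expectedPulls π (bernoulliModel p' hp') b T
      ≤ C * Real.log T := by
    rw [hC, add_mul, Finset.sum_mul]
    refine add_le_add (hT.trans_eq (by ring)) (Finset.sum_le_sum fun b hb => ?_)
    exact (hT' b hb).trans_eq (by ring)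
  have hle : expectedPulls π (bernoulliModel p hp) i₁ T * k ≤
      max k 0 * (c / δ ^ 2) * Real.log T := by
    calc _ ≤ expectedPulls π (bernoulliModel p hp) i₁ T * max k 0 :=
          mul_le_mul_of_nonneg_left (le_max_left _ _) (expectedPulls_nonneg ..)
      _ ≤ c * Real.log T / δ ^ 2 * max k 0 := by gcongr
      _ = _ := by ring
  calc Real.exp (-(max k 0 * (c / δ ^ 2) * Real.log T))
      ≤ Real.exp (expectedPulls π (bernoulliModel p hp) i₁ T * -k) :=
        Real.exp_le_exp.2 (by linarith)
    _ ≤ 2 * (2 / T * (C * Real.log T)) := by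
        refine hBH.trans ?_
        have : (2 : ℝ) / T * (expectedPulls π (bernoulliModel p hp) i₁ T
          + ∑ b ∈ Finset.univ.erase i₁, expectedPulls π (bernoulliModel p' hp') b T) ≤
            2 / T * (C * Real.log T) := by gcongr
        linarith
    _ = _ := by ring

end Bandit

theorem corollary2 {K : ℕ} (hK : 2 ≤ K) :
    -- the kl-UCB index with the quadratic divergence is the UCB index,
    -- so that the two algorithms are the same
    (∀ (t : ℕ) (h : Bandit.History K t) (a : Fin K), 0 < Bandit.numPulls h a →
      Bandit.klUCBIndex Bandit.dQua Bandit.explorationRate t h a = Bandit.ucbIndex t h a) ∧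
    (∀ π : Bandit.Strategy K,
      π.FollowsIndex (Bandit.klUCBIndex Bandit.dQua Bandit.explorationRate) ↔
        π.FollowsIndex Bandit.ucbIndex) ∧
    -- the bound on the expected number of draws of a suboptimal arm
    (∀ π : Bandit.Strategy K, π.FollowsIndex Bandit.ucbIndex →
      ∀ ν : Bandit.Model K, ν.RewardsInUnit →
      ∀ a : Fin K, ν.mean a < ν.bestMean →
      ∀ T : ℕ, 3 ≤ T →
        Bandit.expectedPulls π ν a T ≤
          Real.log T / (2 * ν.gap a ^ 2)
          + 2 * Real.sqrt Real.pi / ν.gap a ^ 2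
              * Real.sqrt (Real.log T + 3 * Real.log (Real.log T))
          + (4 * Real.exp 1 + 3 / (2 * ν.gap a ^ 2)) * Real.log (Real.log T)
          + 8 / ν.gap a ^ 2 + 6) ∧
    -- the leading constant `1 / 2` cannot be improved, by any strategy
    (∀ c : ℝ, c < 1 / 2 → ∀ π : Bandit.Strategy K,
      ∃ ν : Bandit.Model K, ν.RewardsInUnit ∧ ∃ a : Fin K, ν.mean a < ν.bestMean ∧
        ∃ᶠ T : ℕ in Filter.atTop,
          c * Real.log T / ν.gap a ^ 2 < Bandit.expectedPulls π ν a T) := by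
  refine ⟨fun t h a ha => Bandit.klUCBIndex_dQua h ha, Bandit.followsIndex_klUCBIndex_iff,
    fun π hπ ν hν a ha T hT => Bandit.expectedPulls_le hK hπ hν ha hT, fun c hc π => ?_⟩
  exact Bandit.exists_frequently_lt_expectedPulls hK hc π
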